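/- Let $K=\mathbb R$ or $\mathbb C$, fix a linear order on the set $K$, let $n\ge 1$, $N\ge 1$, $s\ge 2$, $m=2s$, and let $\mu\in K$, $\mu\neq 0$. \emph{Polygons.} A twisted $N$-gon in $\mathrm{Gr}(n,mn)$ is a sequence $(l_k)_{k\in\mathbb Z}$ of $n$-dimensional subspaces of $K^{mn}$ with $l_{k+N}=M l_k$ for all $k$ and some $M\in \mathrm{SL}(mn)$. A lift is a sequence of $mn\times n$ matrices $X_k$ whose columns form a basis of $l_k$; it is twisted if $X_{k+N}=MX_k$ for all $k$ and some $M\in \mathrm{SL}(mn)$. The polygon is regular if $\rho_k=(X_k,X_{k+1},\dots,X_{k+m-1})$ is invertible for all $k$. Let $\mathcal P_N$ be the set of regular twisted $N$-gons modulo $\mathrm{SL}(mn)$. The invariants of a twisted lift $X$ of a regular polygon are the $n\times n$ matrices $a_k^i$ with $X_{k+m}=\sum_{i=0}^{m-1}X_{k+i}a_k^i$. \emph{Coordinates.} The family $a=(a_k^i)$ is called a system of moduli coordinates of a point of $\mathcal P_N$ if it consists of the invariants of a twisted lift $V$ of a representative with $\det(V_k,\dots,V_{k+m-1})=1$ for all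 $k$, and if it is in normal form, that is: all products $A_r=a_r^0a_{r+m}^0a_{r+2m}^0\cdots a_{r+(N-1)m}^0$ are equal to one Jordan matrix $J$ with its diagonal entries in increasing order; each $a_k^0$ is block diagonal with upper triangular Toeplitz blocks, along the Jordan blocks of $J$; and, if the diagonal entries of $J$ are pairwise distinct, then for each $k$ all entries in places $(i,i+1)$, $1\le i\le n-1$, of $b^k=a_{k-m+1}^{m-1}a_{k-m+2}^{m-1}\cdots a_{k-m+N}^{m-1}$ are equal to its entry in place $(2,1)$. \emph{Pentagram map.} Let $T(l)_k=\Pi_k\cap\Omega_k$ with $\Pi_k=l_k+l_{k+2}+\dots+l_{k+2s}$ and $\Omega_k=l_{k+1}+l_{k+3}+\dots+l_{k+2s-1}$. This induces a partial map $T$ on $\mathcal P_N$, defined at the class of $l$ when $(T(l)_k)_k$ is a regular twisted $N$-gon in $\mathrm{Gr}(n,mn)$. For a family $a$ let $T(a)$ be the set of all systems of moduli coordinates of $T(x)$, where $x$ is a point with moduli coordinates $a$ at which $T$ is defined (the empty set if there is none). \emph{Scaling.} Let $S_\mu$ be the scaling $a_k^{2r+1}\mapsto \mu a_k^{2r+1}$,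 $a_k^{2r}\mapsto a_k^{2r}$ ($0\le r\le s-1$, $k\in\mathbb Z$). \textbf{Theorem.} \begin{enumerate} \item Two points of $\mathcal P_N$ with a common system of moduli coordinates are equal, and if $a$ is a system of moduli coordinates of some point, then so is $S_\mu a$. \item If $a$ is a system of moduli coordinates of some point, then $b\in T(a)$ if and only if $b$ is $N$-periodic in $k$, is in normal form, and there are $n\times n$ matrices $\lambda_k$ ($k\in\mathbb Z$) with $\det(N_k\Lambda_k)=1$ and $$Q_k(b)=\Lambda_k^{-1}N_k^{-1}Q_k(a)N_{k+1}\Lambda_{k+1}\qquad\text{for all }k .$$ Here $Q_k(a)$ is the block companion matrix with last block column $(a_k^0,\dots,a_k^{m-1})^T$ and identity blocks below the block diagonal, $\Lambda_k=\mathrm{diag}(\lambda_k,\dots,\lambda_{k+m-1})$, and $N_k$ is the matrix with block columns $Q_k(a)Q_{k+1}(a)\cdots Q_{k+i-1}(a)\,\mathbf r_{k+i}$, $0\le i\le m-1$, where $\mathbf r_k$ is the block column $(0,a_k^1,0,a_k^3,\dots,0,a_k^{2s-1})^T$. \item The pentagram map in moduli coordinates is invariant under the scaling: $T(S_\mu a)=S_\mu(T(a))$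 for every $a$. \item The same holds for the invariants of arbitrary twisted lifts. Let $a$ be the invariants of some twisted lift of a representative of $x\in\mathcal P_N$. Then $S_\mu a$ are the invariants of some twisted lift of a representative of some $x'\in\mathcal P_N$; and for every such $x'$, $T$ is defined at $x$ if and only if it is defined at $x'$, and in that case, whenever $b$ are the invariants of a twisted lift of a representative of $T(x)$, $S_\mu b$ are those of a twisted lift of a representative of $T(x')$. \end{enumerate} -/

import Mathlib

/-!
Twisted polygons in the Grassmannian `Gr(n, mn)` over `K`, their moduli space, the normalized
moduli coordinates `a_k^i`, and the pentagram map for `m = 2s`.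

The ambient space `K^(mn)` is `Fin m × Fin n → K`, so that an `mn × mn` matrix is literally an
`m × m` block matrix with `n × n` blocks. Block indices run over `0, …, m-1`.
-/

noncomputable section

namespace GrassmannPentagram

variable {K : Type*} [Field K] {m n : ℕ}

/-- A bi-infinite sequence of subspaces of `K^(mn)`. -/
abbrev SubspaceSeq (K : Type*) [Field K] (m n : ℕ) : Type _ :=
  ℤ → Submodule K (Fin m × Fin n → K)

/-- A bi-infinite sequence of `mn × n` matrices. -/
abbrev MatrixSeq (K : Type*) (m n : ℕ) : Type _ :=
  ℤ → Matrix (Fin m × Fin n) (Fin n) K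

/-- A family `a k i = a_k^i` of `n × n` matrices, `k ∈ ℤ`, `0 ≤ i ≤ m-1`. -/
abbrev Coords (K : Type*) (m n : ℕ) : Type _ :=
  ℤ → Fin m → Matrix (Fin n) (Fin n) K

/-! ### Polygons and lifts -/

/-- `X` is a lift of `l`: the columns of `X_k` form a basis of `l_k` for all `k`. -/
def IsLift (l : SubspaceSeq K m n) (X : MatrixSeq K m n) : Prop :=
  ∀ k, LinearIndependent K (X k).col ∧ Submodule.span K (Set.range (X k).col) = l k

/-- The block matrix `ρ_k = (X_k, X_{k+1}, …, X_{k+m-1})`. -/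
def rho (X : MatrixSeq K m n) (k : ℤ) : Matrix (Fin m × Fin n) (Fin m × Fin n) K :=
  Matrix.of fun p c => X (k + (c.1 : ℕ)) p c.2

/-- The action of `SL(mn)` on sequences of subspaces. -/
def act (g : Matrix.SpecialLinearGroup (Fin m × Fin n) K) (l : SubspaceSeq K m n) :
    SubspaceSeq K m n :=
  fun k => (l k).map (Matrix.SpecialLinearGroup.toLin' g).toLinearMap

/-- `l` is a twisted `N`-gon in `Gr(n, mn)`: `l_{k+N} = M l_k` for some monodromy `M ∈ SL(mn)`. -/
def IsTwistedPolygon (N : ℕ) (l : SubspaceSeq K m n) : Prop :=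
  (∀ k, Module.finrank K (l k) = n) ∧
    ∃ M : Matrix.SpecialLinearGroup (Fin m × Fin n) K, ∀ k, l (k + N) = act M l k

/-- Regularity: `det (X_k, …, X_{k+m-1}) ≠ 0` for all `k`, where `X` is a lift (the condition does
not depend on the lift). -/
def IsRegular (l : SubspaceSeq K m n) : Prop :=
  ∃ X : MatrixSeq K m n, IsLift l X ∧ ∀ k, (rho X k).det ≠ 0

/-- Regular twisted `N`-gons in `Gr(n, mn)`. -/
def IsRegularPolygon (N : ℕ) (l : SubspaceSeq K m n) : Prop :=
  IsTwistedPolygon N l ∧ IsRegular l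

/-- A lift `X` of `l` which is itself twisted: `X_{k+N} = M X_k` for some `M ∈ SL(mn)`. -/
def IsTwistedLift (N : ℕ) (l : SubspaceSeq K m n) (X : MatrixSeq K m n) : Prop :=
  IsLift l X ∧
    ∃ M : Matrix.SpecialLinearGroup (Fin m × Fin n) K, ∀ k, X (k + N) = M.1 * X k

/-! ### The moduli space -/

theorem act_mul (g h : Matrix.SpecialLinearGroup (Fin m × Fin n) K) (l : SubspaceSeq K m n) :
    act (g * h) l = act g (act h l) := by
  funext k
  simp only [act, map_mul]
  rw [← Submodule.map_comp]
  rfl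

theorem act_one (l : SubspaceSeq K m n) : act 1 l = l := by
  funext k
  simp only [act, map_one]
  exact Submodule.map_id _

theorem IsRegularPolygon.act {N : ℕ} {l : SubspaceSeq K m n} (h : IsRegularPolygon N l)
    (g : Matrix.SpecialLinearGroup (Fin m × Fin n) K) :
    IsRegularPolygon N (GrassmannPentagram.act g l) := by
  obtain ⟨⟨hd, M, hM⟩, X, hX, hdet⟩ := h
  refine ⟨⟨fun k => ?_, g * M * g⁻¹, fun k => ?_⟩, fun k => g.1 * X k, fun k => ?_, fun k => ?_⟩
  · exact (LinearEquiv.finrank_map_eq (Matrix.SpecialLinearGroup.toLin' g) (l k)).trans (hd k)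
  · rw [← act_mul, inv_mul_cancel_right, act_mul]
    simp only [GrassmannPentagram.act] at hM ⊢
    rw [hM k]
  · have hcol : (g.1 * X k).col =
        fun j => (Matrix.SpecialLinearGroup.toLin' g).toLinearMap ((X k).col j) := by
      funext j
      ext i
      simp [Matrix.col, Matrix.mul_apply, Matrix.mulVec, dotProduct,
        Matrix.SpecialLinearGroup.toLin'_to_linearMap, Matrix.toLin'_apply]
    obtain ⟨h1, h2⟩ := hX k
    rw [hcol]
    refine ⟨h1.map' _ (LinearEquiv.ker _), ?_⟩
    rw [GrassmannPentagram.act, ← h2, Submodule.map_span, ← Set.range_comp]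
    rfl
  · have : rho (fun k => g.1 * X k) k = g.1 * rho X k := by
      ext p c
      simp [rho, Matrix.mul_apply]
    rw [this, Matrix.det_mul, g.2, one_mul]
    exact hdet k

/-- Two regular twisted `N`-gons are equivalent if they differ by an element of `SL(mn)`. -/
def polygonSetoid (K : Type*) [Field K] (m n N : ℕ) :
    Setoid {l : SubspaceSeq K m n // IsRegularPolygon N l} where
  r l l' := ∃ g : Matrix.SpecialLinearGroup (Fin m × Fin n) K, l'.1 = act g l.1
  iseqv :=
    { refl := fun l => ⟨1, (act_one l.1).symm⟩
      symm := fun {l l'} ⟨g, hg⟩ => ⟨g⁻¹, by rw [hg, ← act_mul, inv_mul_cancel, act_one]⟩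
      trans := fun {l l' l''} ⟨g, hg⟩ ⟨h, hh⟩ => ⟨h * g, by rw [hh, hg, act_mul]⟩ }

/-- The moduli space of regular twisted `N`-gons in `Gr(n, mn)`. -/
def Moduli (K : Type*) [Field K] (m n N : ℕ) : Type _ := Quotient (polygonSetoid K m n N)

/-- The point of the moduli space represented by a regular twisted polygon. -/
def Moduli.mk {N : ℕ} (l : SubspaceSeq K m n) (h : IsRegularPolygon N l) : Moduli K m n N :=
  Quotient.mk (polygonSetoid K m n N) ⟨l, h⟩

/-! ### Invariants and normalized coordinates -/

/-- `X_{k+m} = X_k a_k^0 + X_{k+1} a_k^1 + ⋯ + X_{k+m-1} a_k^{m-1}` for all `k`. -/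
def HasInvariants (X : MatrixSeq K m n) (a : Coords K m n) : Prop :=
  ∀ k, X (k + m) = ∑ i : Fin m, X (k + (i : ℕ)) * a k i

/-- The block `a_k^i` for a natural number `i < m` (zero for `i ≥ m`, which is never used). -/
def coeff (a : Coords K m n) (k : ℤ) (i : ℕ) : Matrix (Fin n) (Fin n) K :=
  if h : i < m then a k ⟨i, h⟩ else 0

/-- The ordered product `A_r = a_r^0 a_{r+m}^0 a_{r+2m}^0 ⋯ a_{r+(N-1)m}^0`. -/
def jordanProd (N : ℕ) (a : Coords K m n) (r : ℤ) : Matrix (Fin n) (Fin n) K :=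
  (List.ofFn fun j : Fin N => coeff a (r + (j : ℕ) * (m : ℤ)) 0).prod

/-- The ordered product `b^k = a_{k-m+1}^{m-1} a_{k-m+2}^{m-1} ⋯ a_{k-m+N}^{m-1}`. -/
def lastProd (N : ℕ) (a : Coords K m n) (k : ℤ) : Matrix (Fin n) (Fin n) K :=
  (List.ofFn fun j : Fin N => coeff a (k - m + 1 + (j : ℕ)) (m - 1)).prod

/-- `J` is a Jordan matrix: it is zero off the diagonal and the superdiagonal, the superdiagonal
entries are `0` or `1`, and an entry `1` joins equal diagonal entries. -/
def IsJordanMatrix (J : Matrix (Fin n) (Fin n) K) : Prop :=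
  (∀ i j : Fin n, J i j ≠ 0 → j = i ∨ (j : ℕ) = i + 1) ∧
    ∀ i j : Fin n, (j : ℕ) = i + 1 → J i j = 0 ∨ (J i j = 1 ∧ J i i = J j j)

/-- The indices `i` and `j` belong to the same Jordan block of the Jordan matrix `J`. -/
def SameBlock (J : Matrix (Fin n) (Fin n) K) (i j : Fin n) : Prop :=
  ∀ p q : Fin n, (q : ℕ) = p + 1 → min i j ≤ p → q ≤ max i j → J p q = 1

/-- `A = diag(r^1, …, r^t)` with upper triangular Toeplitz blocks `r^u`, the blocks being those of
the Jordan matrix `J`. -/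
def IsBlockToeplitz (J A : Matrix (Fin n) (Fin n) K) : Prop :=
  (∀ i j : Fin n, A i j ≠ 0 → i ≤ j ∧ SameBlock J i j) ∧
    ∀ i j i' j' : Fin n, (i' : ℕ) = i + 1 → (j' : ℕ) = j + 1 →
      SameBlock J i j → SameBlock J i i' → SameBlock J j j' → A i j = A i' j'

/-- The normal form of the invariants. All the products `A_r` equal one Jordan matrix `J`, whose
eigenvalues are listed in increasing order for the chosen order `ord` of `K`; each `a_k^0` is block
diagonal with upper triangular Toeplitz blocks, along the Jordan blocks of `J`; and, in the generic
case where the eigenvalues of `J` are pairwise distinct (so that the remaining freedom in the lift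
is diagonal), for every `k` the superdiagonal entries of `b^k` are all equal to its entry in the
second row and first column. -/
def IsNormalForm (ord : LinearOrder K) (N : ℕ) (a : Coords K m n) : Prop :=
  ∃ J : Matrix (Fin n) (Fin n) K,
    IsJordanMatrix J ∧
    (∀ i j : Fin n, i ≤ j → ord.le (J i i) (J j j)) ∧
    (∀ r, jordanProd N a r = J) ∧
    (∀ k, IsBlockToeplitz J (coeff a k 0)) ∧
    ((∀ i j : Fin n, i ≠ j → J i i ≠ J j j) →
      ∀ k, ∀ i j p q : Fin n, (j : ℕ) = i + 1 → (p : ℕ) = 1 → (q : ℕ) = 0 →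
        lastProd N a k i j = lastProd N a k p q)

/-- `a` are the invariants of some twisted lift (not normalized) of the class `x`. -/
def IsInvariants {N : ℕ} (x : Moduli K m n N) (a : Coords K m n) : Prop :=
  ∃ (l : SubspaceSeq K m n) (h : IsRegularPolygon N l) (X : MatrixSeq K m n),
    Moduli.mk l h = x ∧ IsTwistedLift N l X ∧ HasInvariants X a

/-- `a` are moduli coordinates of the class `x`: the invariants, in normal form, of a twisted lift
`V` with `det (V_k, …, V_{k+m-1}) = 1` for all `k`. -/
def IsCoords (ord : LinearOrder K) {N : ℕ} (x : Moduli K m n N) (a : Coords K m n) : Prop :=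
  ∃ (l : SubspaceSeq K m n) (h : IsRegularPolygon N l) (V : MatrixSeq K m n),
    Moduli.mk l h = x ∧ IsTwistedLift N l V ∧ (∀ k, (rho V k).det = 1) ∧
      HasInvariants V a ∧ IsNormalForm ord N a

/-- The scaling `a_k^{2r+1} ↦ μ a_k^{2r+1}`, `a_k^{2r} ↦ a_k^{2r}`. -/
def scale (μ : K) (a : Coords K m n) : Coords K m n :=
  fun k i => if Odd (i : ℕ) then μ • a k i else a k i

/-! ### The pentagram map on `Gr(n, 2sn)` -/

variable {s : ℕ}

/-- The pentagram map on sequences of subspaces: `k ↦ Π_k ∩ Ω_k`, where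
`Π_k = l_k + l_{k+2} + ⋯ + l_{k+2s}` and `Ω_k = l_{k+1} + l_{k+3} + ⋯ + l_{k+2s-1}`. -/
def pentagramSeq (l : SubspaceSeq K (2 * s) n) : SubspaceSeq K (2 * s) n :=
  fun k => (⨆ i : Fin (s + 1), l (k + 2 * (i : ℕ))) ⊓ (⨆ i : Fin s, l (k + 2 * (i : ℕ) + 1))

theorem pentagramSeq_act (g : Matrix.SpecialLinearGroup (Fin (2 * s) × Fin n) K)
    (l : SubspaceSeq K (2 * s) n) : pentagramSeq (act g l) = act g (pentagramSeq l) := by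
  funext k
  simp only [pentagramSeq, act]
  rw [Submodule.map_inf _ (LinearEquiv.injective _), Submodule.map_iSup, Submodule.map_iSup]

/-- The pentagram map on the moduli space, as a partial map. It is defined at the class of `l` when
the subspaces `Π_k ∩ Ω_k` have dimension `n` and form a regular twisted `N`-gon. -/
def pentagram (K : Type*) [Field K] (s n N : ℕ) :
    Moduli K (2 * s) n N →. Moduli K (2 * s) n N :=
  fun x => Quotient.liftOn x
    (fun l => (⟨IsRegularPolygon N (pentagramSeq l.1), fun h => Moduli.mk (pentagramSeq l.1) h⟩ :
      Part (Moduli K (2 * s) n N)))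
    (by
      rintro ⟨l, hl⟩ ⟨l', hl'⟩ ⟨g, hg⟩
      simp only at hg
      subst hg
      refine Part.ext' ⟨fun h => ?_, fun h => ?_⟩ fun h₁ h₂ => ?_
      · simp only [pentagramSeq_act]
        exact h.act g
      · have h' : IsRegularPolygon N (pentagramSeq (act g l)) := h
        have h'' := h'.act g⁻¹
        rwa [← pentagramSeq_act, ← act_mul, inv_mul_cancel, act_one] at h''
      · exact Quotient.sound ⟨g, pentagramSeq_act g l⟩)

/-- The pentagram map written in moduli coordinates: the set of all moduli coordinates of `T(x)`,
where `x` is a point with coordinates `a` at which `T` is defined. -/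
def coordPentagram (ord : LinearOrder K) (s n N : ℕ) (a : Coords K (2 * s) n) :
    Set (Coords K (2 * s) n) :=
  {b | ∃ x y : Moduli K (2 * s) n N, IsCoords ord x a ∧ y ∈ pentagram K s n N x ∧
    IsCoords ord y b}

/-! ### The compatibility formula -/

/-- The block companion matrix `Q_k`, with last block column `(a_k^0, …, a_k^{m-1})` and identity
blocks below the diagonal. -/
def Q (a : Coords K m n) (k : ℤ) : Matrix (Fin m × Fin n) (Fin m × Fin n) K :=
  Matrix.of fun p c =>
    if (c.1 : ℕ) + 1 = m then a k p.1 p.2 c.2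
    else if (p.1 : ℕ) = c.1 + 1 ∧ p.2 = c.2 then 1 else 0

/-- The block column `(0, a_k^1, 0, a_k^3, …, 0, a_k^{2s-1})`. -/
def oddColumn (a : Coords K m n) (k : ℤ) : Matrix (Fin m × Fin n) (Fin n) K :=
  Matrix.of fun p q => if Odd (p.1 : ℕ) then a k p.1 p.2 q else 0

/-- The block column `Q_k Q_{k+1} ⋯ Q_{k+i-1} r_{k+i}`, with `r_j` the odd column of `a_j`. -/
def blockF (a : Coords K m n) (k : ℤ) (i : ℕ) : Matrix (Fin m × Fin n) (Fin n) K :=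
  (List.ofFn fun j : Fin i => Q a (k + (j : ℕ))).prod * oddColumn a (k + i)

/-- The matrix `N_k`, whose `i`-th block column is `Q_k ⋯ Q_{k+i-1} r_{k+i}`. -/
def Nmat (a : Coords K m n) (k : ℤ) : Matrix (Fin m × Fin n) (Fin m × Fin n) K :=
  Matrix.of fun p c => blockF a k (c.1 : ℕ) p c.2

/-- The block diagonal matrix `Λ_k = diag(λ_k, λ_{k+1}, …, λ_{k+m-1})`. -/
def Lam (lam : ℤ → Matrix (Fin n) (Fin n) K) (k : ℤ) :
    Matrix (Fin m × Fin n) (Fin m × Fin n) K :=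
  Matrix.of fun p c => if p.1 = c.1 then lam (k + (p.1 : ℕ)) p.2 c.2 else 0

/-- `b` is obtained from `a` by `T(Q_k) = Λ_k⁻¹ N_k⁻¹ Q_k N_{k+1} Λ_{k+1}`, where the matrices
`λ_k` are such that the result is normalized: `det (N_k Λ_k) = 1` (in particular `N_k` and `Λ_k` are
invertible) and `b` is `N`-periodic and in normal form. -/
def IsCompatible (ord : LinearOrder K) (N : ℕ) (a b : Coords K m n) : Prop :=
  ∃ lam : ℤ → Matrix (Fin n) (Fin n) K,
    (∀ k, (Nmat a k * Lam lam k).det = 1) ∧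
    (∀ k, Q b k = (Lam lam k)⁻¹ * (Nmat a k)⁻¹ * Q a k * Nmat a (k + 1) * Lam lam (k + 1)) ∧
    (∀ k, b (k + N) = b k) ∧
    IsNormalForm ord N b

end GrassmannPentagram

end

open GrassmannPentagram

noncomputable section

open scoped Matrix

namespace GrassmannPentagram

set_option linter.unusedSectionVars false

variable {K : Type*} [Field K] {m n : ℕ}

/-! ### Block matrices -/

/-! Let `X` be a lift with invariants `a`, and let F_k (`oddSum`) be the part of the recurrence for
X_{k+m} with odd i. Then X_{k+m} - F_k is a combination of the X_{k+i} with i even, so the columns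
of F_k lie in both Π_k and Ω_k, and regularity makes them span the intersection
(`pentagramSeq_colSpan`). Lifts of the image are therefore the sequences F_k λ_k, and the identity
ρ_k(F) = ρ_k(X) N_k turns their recurrence into the compatibility formula
(`mem_coordPentagram_iff`).

For the scaling, view X as a row of blocks and put the odd and even parts of the recurrence into
infinite block matrices O and E (`oddBlock`, `evenBlock`). Then F = XO and XE = XO, while a sequence
X' with the scaled invariants satisfies X'E = μX'O. Suppose Fc = 0 with c supported on [k, k+m].
Then X(Oc) = 0, hence Oc = (E - O)d for some d, because the defining relations generate all
relations (`Nondegenerate.exists_quotient`). Now O reverses the parity of positions and E preserves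
it. Write c_0, d_0 and c_1, d_1 for the parts at even and odd distance from k. The even rows give
O(c_1 + d_1) = E d_0. Applying X yields F(c_1 + d_1 - d_0) = 0, a relation between m - 1 consecutive
F_j, so regularity of F forces d_0 = 0 and d_1 = -c_1. The odd rows become O c_0 + E c_1 = 0, which
no longer involves X. Applying X' gives F'c_0 + μF'c_1 = 0 with F' = X'O. Thus if Fλ has invariants
`b`, then F'λ, with the same λ, has invariants `scale μ b` (`HasInvariants.oddSum_scaled`).

Two determinants complete the argument. That of the companion matrix is unchanged by the scaling
(`det_Q_scale`), so X' can be constructed and is again twisted. The ratio of det ρ_k(F) to det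
ρ_{k+1}(X) is a Sylvester-type determinant independent of μ (`exists_sylvester_det`), so regularity
and the determinant normalization pass to F'. -/

theorem det_of_blockUpper {l : ℕ} (M : Matrix (Fin l × Fin n) (Fin l × Fin n) K)
    (h0 : ∀ p c : Fin l × Fin n, c.1 < p.1 → M p c = 0)
    (h1 : ∀ i u v, M (i, u) (i, v) = (1 : Matrix (Fin n) (Fin n) K) u v) : M.det = 1 := by
  have hM : M.BlockTriangular Prod.fst := fun p c h => h0 p c h
  rw [hM.det_fintype]
  refine Finset.prod_eq_one fun i _ => ?_
  have : M.toSquareBlock Prod.fst i = 1 := by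
    ext ⟨⟨p1, p2⟩, hp⟩ ⟨⟨c1, c2⟩, hc⟩
    simp only at hp hc
    subst hp hc
    rw [Matrix.toSquareBlock_def, Matrix.of_apply, h1, Matrix.one_apply, Matrix.one_apply]
    simp
  rw [this, Matrix.det_one]

theorem rho_apply (X : MatrixSeq K m n) (k : ℤ) (p : Fin m × Fin n) (i : Fin m) (q : Fin n) :
    rho X k p (i, q) = X (k + (i : ℕ)) p q := rfl

theorem rho_mul_left (g : Matrix (Fin m × Fin n) (Fin m × Fin n) K) (X : MatrixSeq K m n) (k : ℤ) :
    rho (fun k => g * X k) k = g * rho X k := by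
  ext p c
  simp [rho, Matrix.mul_apply]

theorem rho_mul_right (X : MatrixSeq K m n) (lam : ℤ → Matrix (Fin n) (Fin n) K) (k : ℤ) :
    rho (fun k => X k * lam k) k = rho X k * Lam lam k := by
  ext p ⟨i, q⟩
  simp only [rho, Lam, Matrix.mul_apply, Fintype.sum_prod_type, mul_ite, mul_zero,
    Matrix.of_apply]
  rw [Finset.sum_eq_single i (fun j _ hj => by simp [hj]) (by simp)]
  simp

theorem eq_of_rho_eq (hm : 0 < m) {X Y : MatrixSeq K m n} {k : ℤ} (h : rho X k = rho Y k) :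
    X k = Y k := by
  ext p q
  have := congrFun (congrFun h p) (⟨0, hm⟩, q)
  simpa [rho] using this

theorem mul_Q_apply_of_lt {α : Type*} (R : Matrix α (Fin m × Fin n) K) (a : Coords K m n) (k : ℤ)
    (p : α) (i : ℕ) (hi : i + 1 < m) (q : Fin n) :
    (R * Q a k) p (⟨i, by omega⟩, q) = R p (⟨i + 1, hi⟩, q) := by
  rw [Matrix.mul_apply, Finset.sum_eq_single (⟨i + 1, hi⟩, q)]
  · simp [Q, hi.ne]
  · rintro ⟨j, u⟩ _ hne
    simp only [Q, Matrix.of_apply, hi.ne, if_false]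
    rw [if_neg, mul_zero]
    rintro ⟨h1, h2⟩
    exact hne (Prod.ext (Fin.ext h1) h2)
  · simp

theorem mul_Q_apply_last {α : Type*} (R : Matrix α (Fin m × Fin n) K) (a : Coords K m n) (k : ℤ)
    (p : α) (i : Fin m) (hi : (i : ℕ) + 1 = m) (q : Fin n) :
    (R * Q a k) p (i, q) = ∑ c : Fin m × Fin n, R p c * a k c.1 c.2 q := by
  rw [Matrix.mul_apply]
  simp [Q, hi]

/-- All block columns but the last of the companion matrix merely shift those of `rho`; only the
last one carries a condition. -/
theorem rho_succ_iff (hm : 0 < m) (X : MatrixSeq K m n) (a : Coords K m n) (k : ℤ) :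
    rho X (k + 1) = rho X k * Q a k ↔ X (k + m) = ∑ i : Fin m, X (k + (i : ℕ)) * a k i := by
  have key : ∀ p q, ∑ c : Fin m × Fin n, rho X k p c * a k c.1 c.2 q =
      (∑ i : Fin m, X (k + (i : ℕ)) * a k i) p q := by
    intro p q
    simp [Fintype.sum_prod_type, rho, Matrix.sum_apply, Matrix.mul_apply]
  constructor
  · intro h
    ext p q
    have h1 := congrFun (congrFun h p) (⟨m - 1, by omega⟩, q)
    rw [mul_Q_apply_last _ _ _ _ _ (by simp; omega), key, rho_apply] at h1
    rw [← h1]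
    exact congrArg (fun t => X t p q) (by simp only; omega)
  · intro h
    ext p ⟨i, q⟩
    by_cases hi : (i : ℕ) + 1 = m
    · rw [mul_Q_apply_last _ _ _ _ _ hi, key, ← h, rho_apply]
      exact congrArg (fun t => X t p q) (by omega)
    · have := mul_Q_apply_of_lt (rho X k) a k p i (by omega) q
      rw [show (⟨(i : ℕ), by omega⟩ : Fin m) = i from rfl] at this
      rw [this, rho_apply, rho_apply]
      exact congrArg (fun t => X t p q) (by push_cast; ring)

theorem HasInvariants.rho_succ (hm : 0 < m) {X : MatrixSeq K m n} {a : Coords K m n}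
    (h : HasInvariants X a) (k : ℤ) : rho X (k + 1) = rho X k * Q a k :=
  (rho_succ_iff hm X a k).2 (h k)

theorem Q_injective (hm : 0 < m) {a b : Coords K m n} {k : ℤ} (h : Q a k = Q b k) :
    a k = b k := by
  funext i
  ext u v
  have := congrFun (congrFun h (i, u)) (⟨m - 1, by omega⟩, v)
  have h1 : m - 1 + 1 = m := by omega
  simpa [Q, h1] using this

/-! ### Sequences with given invariants -/

/-- All the matrices `ρ_k` are invertible. -/
def Nondegenerate (X : MatrixSeq K m n) : Prop := ∀ k, (rho X k).det ≠ 0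

theorem HasInvariants.det_succ (hm : 0 < m) {X : MatrixSeq K m n} {a : Coords K m n}
    (h : HasInvariants X a) (k : ℤ) : (rho X (k + 1)).det = (rho X k).det * (Q a k).det := by
  rw [h.rho_succ hm, Matrix.det_mul]

theorem HasInvariants.det_Q_ne_zero (hm : 0 < m) {X : MatrixSeq K m n} {a : Coords K m n}
    (h : HasInvariants X a) (hX : Nondegenerate X) (k : ℤ) : (Q a k).det ≠ 0 := fun h0 =>
  hX (k + 1) (by rw [h.det_succ hm, h0, mul_zero])

theorem HasInvariants.unique (hm : 0 < m) {X : MatrixSeq K m n} {a b : Coords K m n}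
    (ha : HasInvariants X a) (hb : HasInvariants X b) (hX : Nondegenerate X) : a = b := by
  funext k
  refine Q_injective hm ?_
  have h := (ha.rho_succ hm k).symm.trans (hb.rho_succ hm k)
  exact ((Matrix.isUnit_iff_isUnit_det _).2 (hX k).isUnit).mul_left_cancel h

theorem HasInvariants.mul_left {X : MatrixSeq K m n} {a : Coords K m n} (h : HasInvariants X a)
    (g : Matrix (Fin m × Fin n) (Fin m × Fin n) K) : HasInvariants (fun k => g * X k) a := by
  intro k
  simp only [h k, Matrix.mul_sum, Matrix.mul_assoc]

/-- Invertible companion matrices propagate the recurrence in both directions, so one window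
determines the whole sequence. -/
theorem HasInvariants.eq_mul (hm : 0 < m) {X Y : MatrixSeq K m n} {a : Coords K m n}
    (hX : HasInvariants X a) (hY : HasInvariants Y a) (hQ : ∀ k, (Q a k).det ≠ 0)
    (g : Matrix (Fin m × Fin n) (Fin m × Fin n) K) (h0 : rho Y 0 = g * rho X 0) (k : ℤ) :
    Y k = g * X k := by
  have key : ∀ k, rho Y k = g * rho X k := by
    intro k
    induction k using Int.induction_on with
    | zero => exact h0
    | succ i ih => rw [hY.rho_succ hm, hX.rho_succ hm, ih, Matrix.mul_assoc]
    | pred i ih =>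
      have e : (-(i : ℤ) - 1) + 1 = -i := by ring
      have h1 := hY.rho_succ hm (-(i : ℤ) - 1)
      have h2 := hX.rho_succ hm (-(i : ℤ) - 1)
      rw [e] at h1 h2
      rw [h1, h2, ← Matrix.mul_assoc] at ih
      exact ((Matrix.isUnit_iff_isUnit_det _).2 (hQ _).isUnit).mul_right_cancel ih
  exact eq_of_rho_eq (X := Y) (Y := fun k => g * X k) hm ((key k).trans (rho_mul_left g X k).symm)

theorem rho_shift (X : MatrixSeq K m n) (N : ℤ) (k : ℤ) :
    rho (fun k => X (k + N)) k = rho X (k + N) := by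
  ext p c
  simp [rho, add_right_comm]

theorem HasInvariants.shift {X : MatrixSeq K m n} {a : Coords K m n} (h : HasInvariants X a)
    (N : ℤ) : HasInvariants (fun k => X (k + N)) (fun k => a (k + N)) := by
  intro k
  have := h (k + N)
  simp only [add_right_comm _ N] at this ⊢
  exact this

theorem HasInvariants.periodic (hm : 0 < m) {X : MatrixSeq K m n} {a : Coords K m n}
    (h : HasInvariants X a) (hX : Nondegenerate X) {N : ℤ}
    {M : Matrix (Fin m × Fin n) (Fin m × Fin n) K} (hM : ∀ k, X (k + N) = M * X k) (k : ℤ) :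
    a (k + N) = a k := by
  have h1 := h.shift N
  have h2 := h.mul_left M
  have e : (fun k => X (k + N)) = fun k => M * X k := funext hM
  rw [← e] at h2
  have hnd : Nondegenerate fun k => X (k + N) := fun k => by rw [rho_shift]; exact hX _
  exact congrFun (h1.unique hm h2 hnd) k

/-- With periodic invariants the shifted sequence solves the same recurrence, so it differs by one
constant matrix; the determinant condition places that matrix in SL. -/
theorem HasInvariants.twisted (hm : 0 < m) {X : MatrixSeq K m n} {a : Coords K m n}
    (h : HasInvariants X a) (hX : Nondegenerate X) {N : ℤ} (ha : ∀ k, a (k + N) = a k)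
    (hdet : (rho X N).det = (rho X 0).det) :
    ∃ M : Matrix.SpecialLinearGroup (Fin m × Fin n) K, ∀ k, X (k + N) = M.1 * X k := by
  refine ⟨⟨rho X N * (rho X 0)⁻¹, ?_⟩, ?_⟩
  · rw [Matrix.det_mul, Matrix.det_nonsing_inv, hdet, Ring.mul_inverse_cancel _ (hX 0).isUnit]
  · have h1 := h.shift N
    rw [show (fun k => a (k + N)) = a from funext ha] at h1
    refine h.eq_mul hm h1 (h.det_Q_ne_zero hm hX) _ ?_
    rw [rho_shift, zero_add, Matrix.mul_assoc, Matrix.nonsing_inv_mul _ (hX 0).isUnit,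
      Matrix.mul_one]

theorem exists_int_seq_mul {G : Type*} [Group G] (q : ℤ → G) :
    ∃ r : ℤ → G, r 0 = 1 ∧ ∀ k, r (k + 1) = r k * q k := by
  let f : ℕ → G := fun i => Nat.rec 1 (fun j g => g * q j) i
  let b : ℕ → G := fun i => Nat.rec 1 (fun j g => g * (q (-(j : ℤ) - 1))⁻¹) i
  refine ⟨fun k => if 0 ≤ k then f k.toNat else b (-k).toNat, rfl, fun k => ?_⟩
  rcases lt_trichotomy k (-1) with hk | rfl | hk
  · obtain ⟨j, rfl⟩ : ∃ j : ℕ, k = -(j : ℤ) - 2 := ⟨(-k - 2).toNat, by omega⟩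
    have h1 : ¬ (0 : ℤ) ≤ -(j : ℤ) - 2 + 1 := by omega
    have h2 : ¬ (0 : ℤ) ≤ -(j : ℤ) - 2 := by omega
    have e1 : (-(-(j : ℤ) - 2 + 1)).toNat = j + 1 := by omega
    have e2 : (-(-(j : ℤ) - 2)).toNat = j + 2 := by omega
    simp only [h1, h2, if_false, e1, e2]
    have : b (j + 2) = b (j + 1) * (q (-((j + 1 : ℕ) : ℤ) - 1))⁻¹ := rfl
    rw [this, show -((j + 1 : ℕ) : ℤ) - 1 = -(j : ℤ) - 2 by push_cast; ring]
    simp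
  · simp [f, b]
  · obtain ⟨j, rfl⟩ : ∃ j : ℕ, k = j := ⟨k.toNat, by omega⟩
    have h1 : (0 : ℤ) ≤ (j : ℤ) + 1 := by omega
    have e1 : ((j : ℤ) + 1).toNat = j + 1 := by omega
    simp only [h1, Int.natCast_nonneg, if_true, e1, Int.toNat_natCast]
    rfl

theorem exists_hasInvariants (hm : 0 < m) (a : Coords K m n) (hQ : ∀ k, (Q a k).det ≠ 0) :
    ∃ X : MatrixSeq K m n, HasInvariants X a ∧ rho X 0 = 1 ∧ Nondegenerate X := by
  obtain ⟨r, r0, hr⟩ := exists_int_seq_mul fun k =>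
    Matrix.GeneralLinearGroup.mkOfDetNeZero (Q a k) (hQ k)
  have hr' : ∀ k, (r (k + 1)).1 = (r k).1 * Q a k := fun k => by
    rw [hr]
    rfl
  let X : MatrixSeq K m n := fun k => Matrix.of fun p q => (r k).1 p (⟨0, hm⟩, q)
  have hX : ∀ k, rho X k = (r k).1 := by
    -- `X` keeps only the first block column of each partial product; the shift property of the
    -- companion matrix recovers the other columns from later products.
    have key : ∀ (i : ℕ) (hi : i < m) (k : ℤ) p q,
        (r (k + i)).1 p (⟨0, hm⟩, q) = (r k).1 p (⟨i, hi⟩, q) := by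
      intro i
      induction i with
      | zero => intro hi k p q; simp
      | succ i ih =>
        intro hi k p q
        rw [← mul_Q_apply_of_lt (r k).1 a k p i hi q, ← hr', ← ih,
          show k + 1 + (i : ℤ) = k + ((i + 1 : ℕ) : ℤ) by push_cast; ring]
    intro k
    ext p ⟨i, q⟩
    exact key i i.2 k p q
  refine ⟨X, fun k => (rho_succ_iff hm X a k).1 ?_, ?_, fun k => ?_⟩
  · rw [hX, hX, hr']
  · rw [hX, r0]
    rfl
  · rw [hX]
    exact ((Matrix.isUnit_iff_isUnit_det _).1 (r k).isUnit).ne_zero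

/-- Each step multiplies both determinants by the same factor, so their ratio is constant. -/
theorem det_proportional (hm : 0 < m) {X Y : MatrixSeq K m n} {a b : Coords K m n}
    (hX : HasInvariants X a) (hY : HasInvariants Y b) (hXn : Nondegenerate X)
    (hab : ∀ k, (Q a k).det = (Q b k).det) (k : ℤ) :
    (rho Y k).det * (rho X 0).det = (rho X k).det * (rho Y 0).det := by
  induction k using Int.induction_on with
  | zero => ring
  | succ i ih => rw [hX.det_succ hm, hY.det_succ hm, hab]; linear_combination (Q b i).det * ih
  | pred i ih =>
    have e : (-(i : ℤ) - 1) + 1 = -i := by ring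
    have h1 := hX.det_succ hm (-(i : ℤ) - 1)
    have h2 := hY.det_succ hm (-(i : ℤ) - 1)
    rw [e, hab] at h1
    rw [e] at h2
    rw [h1, h2] at ih
    have h3 := hX.det_Q_ne_zero hm hXn (-(i : ℤ) - 1)
    rw [hab] at h3
    refine mul_right_cancel₀ h3 ?_
    linear_combination ih

/-! ### The determinant of the companion matrix under the scaling -/

/-- The block `a k 0` is not scaled. Every other block of the last column can be altered by column
operations with the identity blocks of the earlier columns, that is, by a unipotent factor `1 + Y`.
-/
theorem det_Q_scale (μ : K) (a : Coords K m n) (k : ℤ) :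
    (Q (scale μ a) k).det = (Q a k).det := by
  let Y : Matrix (Fin m × Fin n) (Fin m × Fin n) K := Matrix.of fun p c =>
    if h : (p.1 : ℕ) + 1 < m ∧ (c.1 : ℕ) + 1 = m then
      scale μ a k ⟨p.1 + 1, h.1⟩ p.2 c.2 - a k ⟨p.1 + 1, h.1⟩ p.2 c.2 else 0
  have hT : (1 + Y).det = 1 := by
    refine det_of_blockUpper (1 + Y) (fun p c h => ?_) fun i u v => ?_
    · have h1 : ¬((p.1 : ℕ) + 1 < m ∧ (c.1 : ℕ) + 1 = m) := by
        have := Fin.lt_def.1 h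
        omega
      have h2 : p ≠ c := by
        rintro rfl
        exact lt_irrefl _ h
      rw [Matrix.add_apply, Matrix.one_apply_ne h2, zero_add]
      exact dif_neg h1
    · have h1 : ¬((i : ℕ) + 1 < m ∧ (i : ℕ) + 1 = m) := by omega
      rw [Matrix.add_apply, show Y (i, u) (i, v) = 0 from dif_neg h1, add_zero]
      simp [Matrix.one_apply]
  have hQ : Q (scale μ a) k = Q a k * (1 + Y) := by
    rw [mul_add, mul_one]
    ext ⟨i, u⟩ ⟨j, v⟩
    rw [Matrix.add_apply]
    by_cases hj : (j : ℕ) + 1 = m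
    · have e : ∀ b : Coords K m n, Q b k (i, u) (j, v) = b k i u v := fun b => by simp [Q, hj]
      rw [e, e, Matrix.mul_apply]
      rcases Nat.eq_zero_or_pos (i : ℕ) with hi | hi
      · rw [Finset.sum_eq_zero, add_zero]
        · simp [scale, hi]
        · rintro ⟨r, w⟩ _
          by_cases hr : (r : ℕ) + 1 = m
          · rw [show Y (r, w) (j, v) = 0 from dif_neg (by simp only; omega), mul_zero]
          · simp [Q, hr, hi]
      · obtain ⟨i', hi', rfl⟩ : ∃ (i' : ℕ) (h : i' + 1 < m), i = ⟨i' + 1, h⟩ :=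
          ⟨i - 1, by omega, Fin.ext (by simp only; omega)⟩
        rw [Finset.sum_eq_single ((⟨i', by omega⟩ : Fin m), u)]
        · have h1 : i' + 1 < m ∧ (j : ℕ) + 1 = m := ⟨by omega, hj⟩
          have h3 : Y (⟨i', by omega⟩, u) (j, v) =
              scale μ a k ⟨i' + 1, hi'⟩ u v - a k ⟨i' + 1, hi'⟩ u v := dif_pos h1
          rw [h3]
          simp [Q, h1.1.ne]
        · rintro ⟨r, w⟩ _ hne
          by_cases hr : (r : ℕ) + 1 = m
          · rw [show Y (r, w) (j, v) = 0 from dif_neg (by simp only; omega), mul_zero]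
          · have : ¬(i' = r ∧ u = w) := by
              rintro ⟨h1, h2⟩
              exact hne (Prod.ext (Fin.ext h1.symm) h2.symm)
            simp [Q, hr, this]
        · simp
    · have h0 : (Q a k * Y) (i, u) (j, v) = 0 := by
        rw [Matrix.mul_apply]
        refine Finset.sum_eq_zero fun r _ => ?_
        rw [show Y r (j, v) = 0 from dif_neg (by simp only; omega), mul_zero]
      rw [h0, add_zero]
      simp [Q, hj]
  rw [hQ, Matrix.det_mul, hT, mul_one]

theorem scale_scale (μ ν : K) (a : Coords K m n) : scale μ (scale ν a) = scale (μ * ν) a := by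
  funext k i
  unfold scale
  split_ifs <;> simp [mul_smul]

theorem scale_one (a : Coords K m n) : scale 1 a = a := by
  funext k i
  simp [scale]

/-! ### Column spaces and polygons -/

/-- The sequence of column spaces of a sequence of matrices. -/
def colSpan (X : MatrixSeq K m n) : SubspaceSeq K m n :=
  fun k => Submodule.span K (Set.range (X k).col)

theorem colSpan_eq_range (X : MatrixSeq K m n) (k : ℤ) :
    colSpan X k = LinearMap.range (X k).mulVecLin := (Matrix.range_mulVecLin _).symm

theorem mulVec_mem_colSpan (X : MatrixSeq K m n) (k : ℤ) (v : Fin n → K) :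
    X k *ᵥ v ∈ colSpan X k := by
  rw [colSpan_eq_range]
  exact ⟨v, rfl⟩

theorem colSpan_le_iff (X : MatrixSeq K m n) (k : ℤ) (S : Submodule K (Fin m × Fin n → K)) :
    colSpan X k ≤ S ↔ ∀ v, X k *ᵥ v ∈ S := by
  rw [colSpan_eq_range]
  constructor
  · exact fun h v => h ⟨v, rfl⟩
  · rintro h _ ⟨v, rfl⟩
    exact h v

theorem exists_mul_of_colSpan_le {X Y : MatrixSeq K m n} (h : ∀ k, colSpan Y k ≤ colSpan X k) :
    ∃ lam : ℤ → Matrix (Fin n) (Fin n) K, ∀ k, Y k = X k * lam k := by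
  have key : ∀ k j, ∃ v : Fin n → K, X k *ᵥ v = (Y k).col j := by
    intro k j
    have : (Y k).col j ∈ colSpan X k := h k (Submodule.subset_span ⟨j, rfl⟩)
    rw [colSpan_eq_range] at this
    exact this
  choose c hc using key
  refine ⟨fun k => Matrix.of fun i j => c k j i, fun k => ?_⟩
  ext p j
  exact (congrFun (hc k j) p).symm

theorem colSpan_mul_left (g : Matrix.SpecialLinearGroup (Fin m × Fin n) K) (X : MatrixSeq K m n) :
    colSpan (fun k => g.1 * X k) = act g (colSpan X) := by
  funext k
  rw [colSpan_eq_range, act, colSpan_eq_range, Matrix.mulVecLin_mul, LinearMap.range_comp]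
  rfl

theorem colSpan_mul_right_le (X : MatrixSeq K m n) (lam : ℤ → Matrix (Fin n) (Fin n) K) (k : ℤ) :
    colSpan (fun k => X k * lam k) k ≤ colSpan X k := by
  rw [colSpan_le_iff]
  intro v
  rw [← Matrix.mulVec_mulVec]
  exact mulVec_mem_colSpan _ _ _

theorem Nondegenerate.linearIndependent_rho {X : MatrixSeq K m n} (hX : Nondegenerate X) (k : ℤ) :
    LinearIndependent K (rho X k).col :=
  Matrix.linearIndependent_cols_of_det_ne_zero (hX k)

theorem Nondegenerate.linearIndependent (hm : 0 < m) {X : MatrixSeq K m n}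
    (hX : Nondegenerate X) (k : ℤ) : LinearIndependent K (X k).col := by
  have h := (hX.linearIndependent_rho k).comp (fun q : Fin n => ((⟨0, hm⟩ : Fin m), q))
    fun q q' h => (Prod.ext_iff.1 h).2
  have e : (rho X k).col ∘ (fun q : Fin n => ((⟨0, hm⟩ : Fin m), q)) = (X k).col := by
    funext q
    ext p
    change X (k + ((0 : ℕ) : ℤ)) p q = X k p q
    simp
  rwa [e] at h

theorem Nondegenerate.isLift (hm : 0 < m) {X : MatrixSeq K m n} (hX : Nondegenerate X) :
    IsLift (colSpan X) X := fun k => ⟨hX.linearIndependent hm k, rfl⟩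

theorem IsLift.eq_colSpan {l : SubspaceSeq K m n} {X : MatrixSeq K m n} (h : IsLift l X) :
    l = colSpan X := funext fun k => (h k).2.symm

/-- This makes regularity independent of the lift: `Y = X * lam`, and the determinant of `rho X`
divides that of `rho Y`. -/
theorem Nondegenerate.of_colSpan_le {X Y : MatrixSeq K m n} (hY : Nondegenerate Y)
    (h : ∀ k, colSpan Y k ≤ colSpan X k) : Nondegenerate X := by
  obtain ⟨lam, hl⟩ := exists_mul_of_colSpan_le h
  intro k h0
  refine hY k ?_
  rw [show Y = fun k => X k * lam k from funext hl, rho_mul_right, Matrix.det_mul, h0, zero_mul]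

theorem IsRegular.nondegenerate {l : SubspaceSeq K m n} (hl : IsRegular l) {X : MatrixSeq K m n}
    (h : l = colSpan X) : Nondegenerate X := by
  obtain ⟨Y, hY, hd⟩ := hl
  refine Nondegenerate.of_colSpan_le (Y := Y) hd fun k => ?_
  rw [← hY.eq_colSpan, ← h]

theorem isRegularPolygon_of_nondegenerate (hm : 0 < m) {N : ℕ} {X : MatrixSeq K m n}
    (hX : Nondegenerate X)
    (hM : ∃ M : Matrix.SpecialLinearGroup (Fin m × Fin n) K,
      ∀ k, colSpan X (k + N) = act M (colSpan X) k) : IsRegularPolygon N (colSpan X) := by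
  refine ⟨⟨fun k => ?_, hM⟩, X, hX.isLift hm, hX⟩
  rw [colSpan, finrank_span_eq_card (hX.linearIndependent hm k), Fintype.card_fin]

theorem IsTwistedLift.isRegularPolygon (hm : 0 < m) {N : ℕ} {l : SubspaceSeq K m n}
    {X : MatrixSeq K m n} (h : IsTwistedLift N l X) (hX : Nondegenerate X) :
    IsRegularPolygon N l := by
  rw [h.1.eq_colSpan]
  obtain ⟨-, M, hM⟩ := h
  refine isRegularPolygon_of_nondegenerate hm hX ⟨M, fun k => ?_⟩
  rw [← colSpan_mul_left]
  simp only [colSpan, hM]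

theorem IsTwistedLift.mul_left {N : ℕ} {l : SubspaceSeq K m n}
    {X : MatrixSeq K m n} (h : IsTwistedLift N l X)
    (g : Matrix.SpecialLinearGroup (Fin m × Fin n) K) :
    IsTwistedLift N (act g l) (fun k => g.1 * X k) := by
  obtain ⟨hl, M, hM⟩ := h
  refine ⟨fun k => ⟨?_, ?_⟩, g * M * g⁻¹, fun k => ?_⟩
  · have hcol : (g.1 * X k).col =
        fun j => (Matrix.SpecialLinearGroup.toLin' g).toLinearMap ((X k).col j) := by
      funext j
      ext i
      simp [Matrix.col, Matrix.mul_apply, Matrix.mulVec, dotProduct,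
        Matrix.SpecialLinearGroup.toLin'_to_linearMap, Matrix.toLin'_apply]
    rw [hcol]
    exact (hl k).1.map' _ (LinearEquiv.ker _)
  · rw [hl.eq_colSpan, ← colSpan_mul_left]
    rfl
  · simp only [hM]
    rw [← Matrix.mul_assoc, ← Matrix.mul_assoc]
    have : (g * M * g⁻¹).1 * g.1 = g.1 * M.1 := by
      rw [← Matrix.SpecialLinearGroup.coe_mul, inv_mul_cancel_right,
        Matrix.SpecialLinearGroup.coe_mul]
    rw [this]

/-! ### Passing to a chosen representative in the moduli space -/

theorem Moduli.mk_eq_iff {N : ℕ} {l l' : SubspaceSeq K m n} {h : IsRegularPolygon N l}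
    {h' : IsRegularPolygon N l'} : Moduli.mk l h = Moduli.mk l' h' ↔
      ∃ g : Matrix.SpecialLinearGroup (Fin m × Fin n) K, l' = GrassmannPentagram.act g l :=
  ⟨fun e => Quotient.exact e, fun e => Quotient.sound e⟩

theorem rho_det_SL_mul (g : Matrix.SpecialLinearGroup (Fin m × Fin n) K) (X : MatrixSeq K m n)
    (k : ℤ) : (rho (fun k => g.1 * X k) k).det = (rho X k).det := by
  rw [rho_mul_left, Matrix.det_mul, g.2, one_mul]

theorem isInvariants_mk_iff {N : ℕ} {l : SubspaceSeq K m n} {h : IsRegularPolygon N l}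
    {b : Coords K m n} : IsInvariants (Moduli.mk l h) b ↔
      ∃ W, IsTwistedLift N l W ∧ HasInvariants W b := by
  constructor
  · rintro ⟨l', h', W, e, hW, hb⟩
    obtain ⟨g, rfl⟩ := Moduli.mk_eq_iff.1 e
    exact ⟨_, hW.mul_left g, hb.mul_left _⟩
  · rintro ⟨W, hW, hb⟩
    exact ⟨l, h, W, rfl, hW, hb⟩

theorem isCoords_mk_iff (ord : LinearOrder K) {N : ℕ} {l : SubspaceSeq K m n}
    {h : IsRegularPolygon N l} {b : Coords K m n} : IsCoords ord (Moduli.mk l h) b ↔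
      ∃ W, IsTwistedLift N l W ∧ (∀ k, (rho W k).det = 1) ∧ HasInvariants W b ∧
        IsNormalForm ord N b := by
  constructor
  · rintro ⟨l', h', W, e, hW, hd, hb, hn⟩
    obtain ⟨g, rfl⟩ := Moduli.mk_eq_iff.1 e
    exact ⟨_, hW.mul_left g, fun k => by rw [rho_det_SL_mul, hd], hb.mul_left _, hn⟩
  · rintro ⟨W, hW, hb⟩
    exact ⟨l, h, W, rfl, hW, hb⟩

/-! ### The pentagram map in terms of lifts -/

/-- The odd part `∑ X_{k+i} a_k^i`, over odd `i`, of the recurrence. -/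
def oddSum (X : MatrixSeq K m n) (a : Coords K m n) : MatrixSeq K m n :=
  fun k => ∑ i : Fin m, if Odd (i : ℕ) then X (k + (i : ℕ)) * a k i else 0

theorem oddSum_eq (X : MatrixSeq K m n) (a : Coords K m n) (k : ℤ) :
    oddSum X a k = rho X k * oddColumn a k := by
  ext p q
  simp only [oddSum, Matrix.sum_apply, Matrix.mul_apply, Fintype.sum_prod_type, oddColumn,
    Matrix.of_apply]
  refine Finset.sum_congr rfl fun i _ => ?_
  split_ifs <;> simp [Matrix.mul_apply, rho]

theorem HasInvariants.rho_add (hm : 0 < m) {X : MatrixSeq K m n} {a : Coords K m n}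
    (h : HasInvariants X a) (k : ℤ) (i : ℕ) :
    rho X (k + i) = rho X k * (List.ofFn fun j : Fin i => Q a (k + (j : ℕ))).prod := by
  induction i with
  | zero => simp
  | succ i ih =>
    rw [List.ofFn_succ', List.concat_eq_append, List.prod_append, ← Matrix.mul_assoc]
    simp only [Fin.val_castSucc, Fin.val_last, List.prod_singleton]
    rw [← ih, ← h.rho_succ hm]
    push_cast
    rw [add_assoc]

theorem HasInvariants.rho_oddSum (hm : 0 < m) {X : MatrixSeq K m n} {a : Coords K m n}
    (h : HasInvariants X a) (k : ℤ) : rho (oddSum X a) k = rho X k * Nmat a k := by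
  ext p ⟨i, q⟩
  rw [rho_apply, oddSum_eq, h.rho_add hm, Matrix.mul_assoc]
  rfl

theorem pentagramSeq_colSpan {s : ℕ} {X : MatrixSeq K (2 * s) n} {a : Coords K (2 * s) n}
    (hX : Nondegenerate X) (h : HasInvariants X a) :
    pentagramSeq (colSpan X) = colSpan (oddSum X a) := by
  funext k
  let E : Submodule K (Fin (2 * s) × Fin n → K) := ⨆ i : Fin s, colSpan X (k + 2 * (i : ℕ))
  let O : Submodule K (Fin (2 * s) × Fin n → K) := ⨆ i : Fin s, colSpan X (k + 2 * (i : ℕ) + 1)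
  let F : Submodule K (Fin (2 * s) × Fin n → K) := colSpan (oddSum X a) k
  have hE : ∀ j : Fin (2 * s), ¬ Odd (j : ℕ) → colSpan X (k + (j : ℕ)) ≤ E := by
    intro j hj
    obtain ⟨r, hr⟩ := Nat.not_odd_iff_even.1 hj
    have := le_iSup (fun i : Fin s => colSpan X (k + 2 * (i : ℕ))) ⟨r, by omega⟩
    convert this using 2
    simp only
    omega
  have hO : ∀ j : Fin (2 * s), Odd (j : ℕ) → colSpan X (k + (j : ℕ)) ≤ O := by
    intro j hj
    obtain ⟨r, hr⟩ := hj
    have := le_iSup (fun i : Fin s => colSpan X (k + 2 * (i : ℕ) + 1)) ⟨r, by omega⟩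
    convert this using 2
    simp only
    omega
  have hFO : F ≤ O := by
    refine (colSpan_le_iff _ _ _).2 fun v => ?_
    rw [oddSum, Matrix.sum_mulVec]
    refine Submodule.sum_mem _ fun i _ => ?_
    split_ifs with hi
    · rw [← Matrix.mulVec_mulVec]
      exact hO i hi (mulVec_mem_colSpan _ _ _)
    · simp
  -- Removing the odd part from the recurrence leaves only even-indexed terms, so the last summand
  -- of Π_k may be replaced by `F` modulo `E`.
  have hdecomp : ∀ v, X (k + (2 * s : ℕ)) *ᵥ v - oddSum X a k *ᵥ v ∈ E := by
    intro v
    rw [h k, oddSum, ← Matrix.sub_mulVec, ← Finset.sum_sub_distrib, Matrix.sum_mulVec]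
    refine Submodule.sum_mem _ fun i _ => ?_
    split_ifs with hi
    · simp
    · rw [sub_zero, ← Matrix.mulVec_mulVec]
      exact hE i hi (mulVec_mem_colSpan _ _ _)
  have hP : (⨆ i : Fin (s + 1), colSpan X (k + 2 * (i : ℕ))) = F ⊔ E := by
    have e : (⨆ i : Fin (s + 1), colSpan X (k + 2 * (i : ℕ))) =
        E ⊔ colSpan X (k + (2 * s : ℕ)) := by
      refine le_antisymm (iSup_le fun i => ?_) (sup_le (iSup_le fun i => ?_) ?_)
      · induction i using Fin.lastCases with
        | last => exact le_sup_of_le_right (by simp)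
        | cast i =>
          exact (le_iSup (fun i : Fin s => colSpan X (k + 2 * (i : ℕ))) i).trans le_sup_left
      · exact le_iSup (fun i : Fin (s + 1) => colSpan X (k + 2 * (i : ℕ))) i.castSucc
      · exact le_of_eq_of_le (by simp)
          (le_iSup (fun i : Fin (s + 1) => colSpan X (k + 2 * (i : ℕ))) (Fin.last s))
    rw [e]
    refine le_antisymm (sup_le le_sup_right ?_) (sup_le ?_ le_sup_left)
    · refine (colSpan_le_iff _ _ _).2 fun v => ?_
      rw [← sub_add_cancel (X (k + (2 * s : ℕ)) *ᵥ v) (oddSum X a k *ᵥ v)]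
      exact Submodule.add_mem _ (Submodule.mem_sup_right (hdecomp v))
        (Submodule.mem_sup_left (mulVec_mem_colSpan _ _ _))
    · refine (colSpan_le_iff _ _ _).2 fun v => ?_
      rw [← sub_sub_cancel (X (k + (2 * s : ℕ)) *ᵥ v) (oddSum X a k *ᵥ v)]
      exact Submodule.sub_mem _ (Submodule.mem_sup_right (mulVec_mem_colSpan _ _ _))
        (Submodule.mem_sup_left (hdecomp v))
  have hEO : Disjoint E O := by
    have hd := (hX.linearIndependent_rho k).disjoint_span_image
      (s := {c | ¬ Odd (c.1 : ℕ)}) (t := {c | Odd (c.1 : ℕ)})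
      (Set.disjoint_left.2 fun c h1 h2 => h1 h2)
    refine hd.mono (iSup_le fun i => ?_) (iSup_le fun i => ?_)
    · refine Submodule.span_mono ?_
      rintro _ ⟨q, rfl⟩
      refine ⟨(⟨2 * i, by omega⟩, q), by simp, ?_⟩
      ext p
      simp [rho, Matrix.col]
    · refine Submodule.span_mono ?_
      rintro _ ⟨q, rfl⟩
      refine ⟨(⟨2 * i + 1, by omega⟩, q), by simp, ?_⟩
      ext p
      simp [rho, Matrix.col, add_assoc]
  change (⨆ i : Fin (s + 1), colSpan X (k + 2 * (i : ℕ))) ⊓ O = F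
  -- Modular law: since `F ≤ O`, (F + E) ∩ O = F + (E ∩ O), and E ∩ O = 0.
  rw [hP, sup_inf_assoc_of_le _ hFO, hEO.eq_bot, sup_bot_eq]

theorem isRegularPolygon_pentagramSeq_iff {s N : ℕ} (hs : 0 < s) {X : MatrixSeq K (2 * s) n}
    {a : Coords K (2 * s) n} (hX : Nondegenerate X) (h : HasInvariants X a)
    (hN : IsRegularPolygon N (colSpan X)) :
    IsRegularPolygon N (pentagramSeq (colSpan X)) ↔ Nondegenerate (oddSum X a) := by
  have e := pentagramSeq_colSpan hX h
  constructor
  · exact fun hr => hr.2.nondegenerate e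
  · intro hn
    rw [e]
    -- The construction commutes with shifts and with the linear action, so the monodromy of the
    -- polygon also serves for its image.
    obtain ⟨⟨-, M, hM⟩, -⟩ := hN
    refine isRegularPolygon_of_nondegenerate (by omega) hn ⟨M, fun k => ?_⟩
    rw [← e, ← pentagramSeq_act]
    simp only [pentagramSeq, ← hM, add_right_comm _ (N : ℤ)]

theorem mem_pentagram_mk_iff {s N : ℕ} {l : SubspaceSeq K (2 * s) n}
    {h : IsRegularPolygon N l} {y : Moduli K (2 * s) n N} :
    y ∈ pentagram K s n N (Moduli.mk l h) ↔
      ∃ h' : IsRegularPolygon N (pentagramSeq l), y = Moduli.mk (pentagramSeq l) h' := by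
  constructor
  · rintro ⟨h', rfl⟩
    exact ⟨h', rfl⟩
  · rintro ⟨h', rfl⟩
    exact ⟨h', rfl⟩

theorem pentagram_dom_mk_iff {s N : ℕ} {l : SubspaceSeq K (2 * s) n}
    {h : IsRegularPolygon N l} :
    (pentagram K s n N (Moduli.mk l h)).Dom ↔ IsRegularPolygon N (pentagramSeq l) := Iff.rfl

/-! ### The scaled recurrence -/

/-- The block in place `(t, j)` of the odd part of the recurrence, an infinite block matrix. -/
def oddBlock (a : Coords K m n) (t j : ℤ) : Matrix (Fin n) (Fin n) K :=
  ∑ i : Fin m, if Odd (i : ℕ) ∧ t = j + (i : ℕ) then a j i else 0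

/-- The block in place `(t, j)` of the even part of the recurrence, with its leading term. -/
def evenBlock (a : Coords K m n) (t j : ℤ) : Matrix (Fin n) (Fin n) K :=
  (if t = j + m then 1 else 0) -
    ∑ i : Fin m, if ¬ Odd (i : ℕ) ∧ t = j + (i : ℕ) then a j i else 0

theorem oddBlock_eq_zero (a : Coords K m n) {t j : ℤ}
    (h : ¬ (j < t ∧ t < j + m) ∨ ¬ Odd (t - j)) : oddBlock a t j = 0 := by
  refine Finset.sum_eq_zero fun i _ => if_neg ?_
  rintro ⟨h1, h2⟩
  obtain ⟨r, hr⟩ := h1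
  rcases h with h | h
  · omega
  · exact h ⟨r, by omega⟩

theorem evenBlock_eq_zero (a : Coords K m n) (hm : Even m) {t j : ℤ}
    (h : ¬ (j ≤ t ∧ t ≤ j + m) ∨ Odd (t - j)) : evenBlock a t j = 0 := by
  have h1 : t ≠ j + m := by
    rintro rfl
    rcases h with h | h
    · omega
    · rw [add_sub_cancel_left] at h
      exact Int.not_odd_iff_even.2 (by exact_mod_cast hm) h
  rw [evenBlock, if_neg h1, zero_sub, neg_eq_zero]
  refine Finset.sum_eq_zero fun i _ => if_neg ?_
  rintro ⟨h1, h2⟩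
  rcases h with h | h
  · omega
  · rw [h2, add_sub_cancel_left] at h
    exact h1 (by exact_mod_cast h)

theorem evenBlock_leading (a : Coords K m n) (j : ℤ) : evenBlock a (j + m) j = 1 := by
  rw [evenBlock, if_pos rfl, Finset.sum_eq_zero, sub_zero]
  exact fun i _ => if_neg (by omega)

/-! ### Products with the infinite block matrices as sums over finite windows -/

theorem sum_mul_ite_block (X : MatrixSeq K m n) (a : Coords K m n) (P : ℕ → Prop)
    [DecidablePred P] (S : Finset ℤ) (j : ℤ) (hS : ∀ i : Fin m, P i → j + (i : ℕ) ∈ S) :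
    ∑ t ∈ S, X t * (∑ i : Fin m, if P i ∧ t = j + (i : ℕ) then a j i else 0) =
      ∑ i : Fin m, if P i then X (j + (i : ℕ)) * a j i else 0 := by
  simp only [Matrix.mul_sum]
  rw [Finset.sum_comm]
  refine Finset.sum_congr rfl fun i _ => ?_
  by_cases hi : P i
  · rw [Finset.sum_eq_single (j + (i : ℕ))]
    · simp [hi]
    · intro t _ ht
      simp [ht]
    · exact fun h => absurd (hS i hi) h
  · simp [hi]

theorem sum_mul_oddBlock (X : MatrixSeq K m n) (a : Coords K m n) (S : Finset ℤ) (j : ℤ)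
    (hS : Finset.Ioo j (j + m) ⊆ S) : ∑ t ∈ S, X t * oddBlock a t j = oddSum X a j := by
  refine sum_mul_ite_block X a Odd S j fun i hi => hS ?_
  have := hi.pos
  simp only [Finset.mem_Ioo]
  omega

/-- The even terms of the scaled recurrence cancel against the leading term, leaving its odd terms,
each with the factor `μ`. -/
theorem sum_mul_evenBlock {X : MatrixSeq K m n} {a : Coords K m n} {μ : K}
    (hX : HasInvariants X (scale μ a)) (S : Finset ℤ) (j : ℤ)
    (hS : Finset.Icc j (j + m) ⊆ S) :
    ∑ t ∈ S, X t * evenBlock a t j = μ • oddSum X a j := by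
  simp only [evenBlock, Matrix.mul_sub, Finset.sum_sub_distrib]
  rw [sum_mul_ite_block X a (fun i => ¬ Odd i) S j
    (fun i _ => hS (by simp only [Finset.mem_Icc]; omega))]
  have h1 : j + (m : ℤ) ∈ S := hS (by simp)
  rw [Finset.sum_eq_single (j + (m : ℤ)) (fun t _ ht => by simp [ht]) (fun h => absurd h1 h),
    if_pos rfl, Matrix.mul_one, hX j, oddSum, Finset.smul_sum, ← Finset.sum_sub_distrib]
  refine Finset.sum_congr rfl fun i _ => ?_
  by_cases hi : Odd (i : ℕ) <;> simp [hi, scale]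

theorem sum_fin_eq_sum_Ico {α : Type*} [AddCommMonoid α] (f : ℤ → α) (k : ℤ) (L : ℕ) :
    ∑ i : Fin L, f (k + (i : ℕ)) = ∑ t ∈ Finset.Ico k (k + L), f t := by
  refine Finset.sum_nbij (fun i => k + (i : ℕ)) (fun i _ => ?_) (fun i _ j _ h => ?_)
    (fun t ht => ?_) fun _ _ => rfl
  · simp only [Finset.mem_Ico]
    omega
  · simp only at h
    exact Fin.ext (by omega)
  · simp only [Finset.coe_Ico, Set.mem_Ico] at ht
    exact ⟨⟨(t - k).toNat, by omega⟩, by simp, by simp only; omega⟩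

theorem sum_Ico_add_one {α : Type*} [AddCommMonoid α] (f : ℤ → α) {k l : ℤ} (h : k ≤ l) :
    ∑ t ∈ Finset.Ico k (l + 1), f t = ∑ t ∈ Finset.Ico k l, f t + f l := by
  have : Finset.Ico k (l + 1) = insert l (Finset.Ico k l) := by
    ext t
    simp only [Finset.mem_Ico, Finset.mem_insert]
    omega
  rw [this, Finset.sum_insert (by simp), add_comm]

theorem sum_mul_sum_comm {ι : Type*} (T : Finset ℤ) (S : Finset ι) (X : MatrixSeq K m n)
    (R : ℤ → ι → Matrix (Fin n) (Fin n) K) (c : ι → Matrix (Fin n) (Fin n) K) :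
    ∑ t ∈ T, X t * ∑ j ∈ S, R t j * c j = ∑ j ∈ S, (∑ t ∈ T, X t * R t j) * c j := by
  simp only [Matrix.mul_sum, Matrix.sum_mul, Matrix.mul_assoc]
  exact Finset.sum_comm

theorem Nondegenerate.eq_zero_of_sum {X : MatrixSeq K m n} (hX : Nondegenerate X) (k : ℤ)
    (p : ℤ → Matrix (Fin n) (Fin n) K)
    (hp : ∑ t ∈ Finset.Ico k (k + m), X t * p t = 0) : ∀ t ∈ Finset.Ico k (k + m), p t = 0 := by
  rw [← sum_fin_eq_sum_Ico] at hp
  let C : Matrix (Fin m × Fin n) (Fin n) K := Matrix.of fun c v => p (k + (c.1 : ℕ)) c.2 v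
  have hC : rho X k * C = 0 := by
    rw [← hp]
    ext q v
    simp [C, rho, Matrix.sum_apply, Matrix.mul_apply, Fintype.sum_prod_type]
  have h0 : C = 0 := by
    have := congrArg (fun B => (rho X k)⁻¹ * B) hC
    simpa [← Matrix.mul_assoc, Matrix.nonsing_inv_mul _ (hX k).isUnit] using this
  intro t ht
  rw [Finset.mem_Ico] at ht
  ext u v
  have h1 := congrFun (congrFun h0 ((⟨(t - k).toNat, by omega⟩ : Fin m), u)) v
  have h2 : k + ((t - k).toNat : ℤ) = t := by omega
  simpa only [C, Matrix.of_apply, h2, Matrix.zero_apply] using h1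

/-- A relation between the `X_t` is a combination of the defining relations. -/
theorem Nondegenerate.exists_quotient {X : MatrixSeq K m n} (hX : Nondegenerate X)
    (R : ℤ → ℤ → Matrix (Fin n) (Fin n) K) (hR : ∀ t j : ℤ, j + m < t → R t j = 0)
    (hR1 : ∀ j, R (j + m) j = 1)
    (hXR : ∀ (S : Finset ℤ) (j : ℤ), Finset.Icc j (j + m) ⊆ S → ∑ t ∈ S, X t * R t j = 0)
    (k : ℤ) (L : ℕ) (p : ℤ → Matrix (Fin n) (Fin n) K)
    (hp : ∑ t ∈ Finset.Ico k (k + L + m), X t * p t = 0) :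
    ∃ d : ℤ → Matrix (Fin n) (Fin n) K, ∀ t ∈ Finset.Ico k (k + L + m),
      p t = ∑ j ∈ Finset.Ico k (k + L), R t j * d j := by
  induction L generalizing p with
  | zero =>
    refine ⟨0, fun t ht => ?_⟩
    simp only [Nat.cast_zero, add_zero] at hp ht
    simpa using hX.eq_zero_of_sum k p hp t ht
  | succ L ih =>
    have e1 : k + ((L + 1 : ℕ) : ℤ) + m = (k + L + m) + 1 := by push_cast; ring
    have e2 : k + ((L + 1 : ℕ) : ℤ) = (k + L) + 1 := by push_cast; ring
    rw [e1] at hp ⊢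
    rw [e2]
    have hlast : R (k + L + m) (k + L) = 1 := hR1 _
    -- Division by columns with leading block 1: subtracting column `k + L` times the top
    -- coefficient shortens the window by one. The process ends at `m` consecutive terms, where no
    -- nonzero relation is left.
    set c := p (k + L + m) with hc
    obtain ⟨d, hd⟩ := ih (fun t => p t - R t (k + L) * c) (by
      have h1 : ∑ t ∈ Finset.Ico k (k + L + m + 1), X t * (p t - R t (k + L) * c) = 0 := by
        simp only [Matrix.mul_sub, Finset.sum_sub_distrib, hp, zero_sub, neg_eq_zero,
          ← Matrix.mul_assoc, ← Matrix.sum_mul]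
        rw [hXR, Matrix.zero_mul]
        intro t
        simp only [Finset.mem_Icc, Finset.mem_Ico]
        omega
      rw [sum_Ico_add_one _ (by omega)] at h1
      simpa [hlast, ← hc] using h1)
    refine ⟨Function.update d (k + L) c, fun t ht => ?_⟩
    rw [Finset.mem_Ico] at ht
    rw [sum_Ico_add_one _ (by omega), Function.update_self]
    have hupd : ∑ j ∈ Finset.Ico k (k + L), R t j * Function.update d (k + L) c j =
        ∑ j ∈ Finset.Ico k (k + L), R t j * d j := by
      refine Finset.sum_congr rfl fun j hj => ?_
      rw [Finset.mem_Ico] at hj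
      rw [Function.update_of_ne (by omega)]
    rw [hupd]
    rcases (Int.lt_add_one_iff.1 ht.2).lt_or_eq with h | rfl
    · rw [← hd t (Finset.mem_Ico.2 ⟨ht.1, h⟩), sub_add_cancel]
    · rw [Finset.sum_eq_zero, hlast, zero_add, one_mul]
      intro j hj
      rw [Finset.mem_Ico] at hj
      rw [hR _ _ (by omega), zero_mul]

/-- The parity argument. `X` serves only to derive an identity between coefficient blocks, which is
then applied to `X'`. -/
theorem sum_oddSum_mul_scaled (hm : Even m) (hm0 : 0 < m) {X X' : MatrixSeq K m n}
    {a : Coords K m n}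
    {μ : K} (hX : Nondegenerate X) (hXa : HasInvariants X a) (hF : Nondegenerate (oddSum X a))
    (hX' : HasInvariants X' (scale μ a)) (k : ℤ) (c : ℤ → Matrix (Fin n) (Fin n) K)
    (hc : ∑ j ∈ Finset.Icc k (k + m), oddSum X a j * c j = 0) :
    ∑ j ∈ Finset.Icc k (k + m), oddSum X' a j * (if Odd (j - k) then μ • c j else c j) = 0 := by
  -- The unscaled recurrence is the case μ = 1 of `sum_mul_evenBlock`.
  rw [← scale_one a] at hXa
  have hodd : ∀ {t j : ℤ}, ¬ Odd (t - j) → oddBlock a t j = 0 :=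
    fun h => oddBlock_eq_zero a (Or.inr h)
  have heven : ∀ {t j : ℤ}, Odd (t - j) → evenBlock a t j = 0 :=
    fun h => evenBlock_eq_zero a hm (Or.inr h)
  have hmZ : Even (m : ℤ) := by exact_mod_cast hm
  set S := Finset.Icc k (k + m) with hS
  -- `T` = [k+1, k+2m-1] holds every X_t that occurs in F_k, …, F_{k+m}. The relations whose full
  -- support [j, j+m] lies in `T` are those with j in `D` = [k+1, k+m-1].
  set T := Finset.Ico (k + 1) (k + 1 + (m - 1 : ℕ) + m) with hT
  set D := Finset.Ico (k + 1) (k + 1 + (m - 1 : ℕ)) with hD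
  have hST : ∀ j ∈ S, Finset.Ioo j (j + m) ⊆ T := by
    intro j hj t ht
    simp only [hS, hT, Finset.mem_Icc, Finset.mem_Ico, Finset.mem_Ioo] at *
    omega
  have hDT : ∀ j ∈ D, Finset.Icc j (j + m) ⊆ T := by
    intro j hj t ht
    simp only [hD, hT, Finset.mem_Icc, Finset.mem_Ico] at *
    omega
  have hDS : D ⊆ S := by
    intro j
    simp only [hD, hS, Finset.mem_Icc, Finset.mem_Ico]
    omega
  -- The two end points of `S` are at even distance from `k` because `m` is even.
  have hSD : ∀ j ∈ S, Odd (j - k) → j ∈ D := by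
    intro j hj ho
    have h1 : j ≠ k := by
      rintro rfl
      simp at ho
    have h2 : j ≠ k + m := by
      rintro rfl
      rw [add_sub_cancel_left] at ho
      exact Int.not_odd_iff_even.2 hmZ ho
    simp only [hD, hS, Finset.mem_Icc, Finset.mem_Ico] at *
    omega
  obtain ⟨d, hd⟩ := hX.exists_quotient (fun t j => evenBlock a t j - oddBlock a t j)
    (fun t j h => by
      rw [evenBlock_eq_zero a hm (Or.inl (by omega)), oddBlock_eq_zero a (Or.inl (by omega)),
        sub_zero])
    (fun j => by
      rw [evenBlock_leading, oddBlock_eq_zero a (Or.inl (by omega)), sub_zero])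
    (fun U j hU => by
      simp only [Matrix.mul_sub, Finset.sum_sub_distrib]
      rw [sum_mul_evenBlock hXa U j hU, one_smul,
        sum_mul_oddBlock X a U j (Finset.Ioo_subset_Icc_self.trans hU), sub_self])
    (k + 1) (m - 1) (fun t => ∑ j ∈ S, oddBlock a t j * c j) (by
      rw [← hT, sum_mul_sum_comm, ← hc]
      refine Finset.sum_congr rfl fun j hj => ?_
      rw [sum_mul_oddBlock X a T j (hST j hj)])
  rw [← hT, ← hD] at hd
  have hpar : ∀ t j : ℤ, Odd (t - j) ↔ ¬ (Odd (t - k) ↔ Odd (j - k)) := by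
    intro t j
    rw [show t - j = (t - k) - (j - k) by ring, Int.odd_sub]
    simp only [← Int.not_odd_iff_even]
    tauto
  -- Even rows: odd positions contribute O(c + d) and even positions -E d. Applying X turns both O
  -- and E into F, and the resulting relation has at most m - 1 consecutive terms.
  have hx : ∀ j ∈ D, (if Odd (j - k) then c j + d j else - d j) = 0 := by
    set x : ℤ → Matrix (Fin n) (Fin n) K := fun j => if Odd (j - k) then c j + d j else - d j
      with hxdef
    have hy : ∀ t ∈ T, ∑ j ∈ D,
        (if Odd (j - k) then oddBlock a t j else evenBlock a t j) * x j = 0 := by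
      intro t ht
      by_cases hto : Odd (t - k)
      · refine Finset.sum_eq_zero fun j hj => ?_
        by_cases ho : Odd (j - k)
        · rw [if_pos ho, hodd (by rw [hpar]; tauto), zero_mul]
        · rw [if_neg ho, heven (by rw [hpar]; tauto), zero_mul]
      · have h1 := hd t ht
        rw [← Finset.sum_subset hDS fun j hj hj' => by
          rw [hodd (by rw [hpar]; have := fun h => hj' (hSD j hj h); tauto), zero_mul],
          ← sub_eq_zero, ← Finset.sum_sub_distrib] at h1
        rw [← h1]
        refine Finset.sum_congr rfl fun j hj => ?_
        by_cases ho : Odd (j - k)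
        · simp only [hxdef, ho, if_true]
          rw [heven (t := t) (j := j) (by rw [hpar]; tauto)]
          noncomm_ring
        · simp only [hxdef, ho, if_false]
          rw [hodd (t := t) (j := j) (by rw [hpar]; tauto)]
          noncomm_ring
    have h0 : ∑ t ∈ T, X t * (∑ j ∈ D,
        (if Odd (j - k) then oddBlock a t j else evenBlock a t j) * x j) = 0 :=
      Finset.sum_eq_zero fun t ht => by rw [hy t ht, Matrix.mul_zero]
    rw [sum_mul_sum_comm] at h0
    have h1 : ∑ j ∈ D, oddSum X a j * x j = 0 := by
      rw [← h0]
      refine Finset.sum_congr rfl fun j hj => ?_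
      by_cases ho : Odd (j - k)
      · simp only [ho, if_true]
        rw [sum_mul_oddBlock X a T j (hST j (hDS hj))]
      · simp only [ho, if_false]
        rw [sum_mul_evenBlock hXa T j (hDT j hj), one_smul]
    have hDD : D ⊆ Finset.Ico (k + 1) (k + 1 + m) := Finset.Ico_subset_Ico_right (by omega)
    intro j hj
    have h2 := hF.eq_zero_of_sum (k + 1) (fun j => if j ∈ D then x j else 0) (by
      rw [← h1, ← Finset.sum_subset hDD fun j _ hj => by rw [if_neg hj, Matrix.mul_zero]]
      exact Finset.sum_congr rfl fun j hj => by rw [if_pos hj]) j (hDD hj)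
    simpa only [hj, if_true] using h2
  have hdodd : ∀ j ∈ D, Odd (j - k) → d j = - c j := fun j hj ho => by
    have := hx j hj
    rw [if_pos ho] at this
    exact eq_neg_of_add_eq_zero_right this
  have hdeven : ∀ j ∈ D, ¬ Odd (j - k) → d j = 0 := fun j hj ho => by
    have := hx j hj
    rwa [if_neg ho, neg_eq_zero] at this
  -- Odd rows, after inserting the values found for `d`; in the even rows every term vanishes by
  -- parity.
  have hz : ∀ t ∈ T, ∑ j ∈ S,
      (if Odd (j - k) then evenBlock a t j else oddBlock a t j) * c j = 0 := by
    intro t ht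
    by_cases hto : Odd (t - k)
    · have h1 : ∀ j, (if Odd (j - k) then evenBlock a t j else oddBlock a t j) * c j =
          oddBlock a t j * c j + if Odd (j - k) then evenBlock a t j * c j else 0 := by
        intro j
        by_cases hj : Odd (j - k)
        · rw [if_pos hj, if_pos hj, hodd (by rw [hpar]; tauto), zero_mul, zero_add]
        · rw [if_neg hj, if_neg hj, add_zero]
      simp only [h1, Finset.sum_add_distrib]
      rw [hd t ht, ← Finset.sum_subset hDS fun j hj hj' => if_neg fun h => hj' (hSD j hj h),
        ← Finset.sum_add_distrib]
      refine Finset.sum_eq_zero fun j hj => ?_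
      by_cases ho : Odd (j - k)
      · rw [if_pos ho, hdodd j hj ho, hodd (by rw [hpar]; tauto)]
        simp
      · rw [if_neg ho, hdeven j hj ho]
        simp
    · refine Finset.sum_eq_zero fun j hj => ?_
      by_cases ho : Odd (j - k)
      · rw [if_pos ho, heven (by rw [hpar]; tauto), zero_mul]
      · rw [if_neg ho, hodd (by rw [hpar]; tauto), zero_mul]
  have h0 : ∑ t ∈ T, X' t * (∑ j ∈ S,
      (if Odd (j - k) then evenBlock a t j else oddBlock a t j) * c j) = 0 :=
    Finset.sum_eq_zero fun t ht => by rw [hz t ht, Matrix.mul_zero]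
  rw [sum_mul_sum_comm] at h0
  rw [← h0]
  refine Finset.sum_congr rfl fun j hj => ?_
  by_cases ho : Odd (j - k)
  · simp only [ho, if_true]
    rw [sum_mul_evenBlock hX' T j (hDT j (hSD j hj ho)), Matrix.mul_smul, Matrix.smul_mul]
  · simp only [ho, if_false]
    rw [sum_mul_oddBlock X' a T j (hST j hj)]

/-- The odd sums of a lift with the scaled invariants have the scaled invariants. -/
theorem HasInvariants.oddSum_scaled (hm : Even m) (hm0 : 0 < m) {X X' : MatrixSeq K m n}
    {a b : Coords K m n} {μ : K} (hX : Nondegenerate X) (hXa : HasInvariants X a)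
    (hF : Nondegenerate (oddSum X a)) (hX' : HasInvariants X' (scale μ a))
    {lam : ℤ → Matrix (Fin n) (Fin n) K} (hb : HasInvariants (fun k => oddSum X a k * lam k) b) :
    HasInvariants (fun k => oddSum X' a k * lam k) (scale μ b) := by
  intro k
  -- The recurrence of `oddSum X a * lam`, moved to one side as a relation between the odd sums.
  let c : ℤ → Matrix (Fin n) (Fin n) K := fun j =>
    if j = k + m then lam j else - (lam j * coeff b k (j - k).toNat)
  have hIcc : Finset.Icc k (k + m) = Finset.Ico k (k + m + 1) := by
    ext j
    simp only [Finset.mem_Icc, Finset.mem_Ico]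
    omega
  have hci : ∀ i : Fin m, c (k + (i : ℕ)) = - (lam (k + (i : ℕ)) * b k i) := by
    intro i
    simp only [c]
    rw [if_neg (by omega), add_sub_cancel_left, Int.toNat_natCast, coeff, dif_pos i.2]
  have hcm : c (k + m) = lam (k + m) := if_pos rfl
  have hsum := sum_oddSum_mul_scaled hm hm0 hX hXa hF hX' k c (by
    rw [hIcc, sum_Ico_add_one _ (by omega), ← sum_fin_eq_sum_Ico, hcm, show _ * _ = _ from hb k]
    simp only [hci, Matrix.mul_neg, Finset.sum_neg_distrib, ← Matrix.mul_assoc]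
    exact neg_add_cancel _)
  -- The leading position `k + m` is at even distance from `k`, so its coefficient stays unscaled.
  rw [hIcc, sum_Ico_add_one _ (by omega), ← sum_fin_eq_sum_Ico, if_neg (by
    rw [add_sub_cancel_left, Int.not_odd_iff_even]
    exact_mod_cast hm), hcm] at hsum
  change oddSum X' a (k + m) * lam (k + m) = _
  rw [eq_neg_of_add_eq_zero_right hsum, ← Finset.sum_neg_distrib]
  refine Finset.sum_congr rfl fun i _ => ?_
  rw [hci, add_sub_cancel_left, scale]
  simp only [Int.odd_coe_nat]
  split_ifs <;> simp [Matrix.mul_assoc]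

/-- The `p × q` window at `(t, j)` of an infinite block matrix. -/
def window (p q : ℕ) (R : ℤ → ℤ → Matrix (Fin n) (Fin n) K) (t j : ℤ) :
    Matrix (Fin p × Fin n) (Fin q × Fin n) K :=
  Matrix.of fun x y => R (t + (x.1 : ℕ)) (j + (y.1 : ℕ)) x.2 y.2

/-- The determinant of the odd sums does not change under the scaling. -/
theorem exists_sylvester_det (hm : Even m) (hm0 : 2 ≤ m) (a : Coords K m n) (k : ℤ) :
    ∃ r : K, ∀ (μ : K) (X : MatrixSeq K m n), HasInvariants X (scale μ a) →
      (rho (oddSum X a) k).det = (rho X (k + 1)).det * r := by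
  -- F_k, …, F_{k+m-1} involve the 2m - 2 = (l+2) + l blocks X_{k+1}, …, X_{k+2m-2}; the `l`
  -- relations starting at k+1, …, k+l complete their coefficients to a square matrix.
  obtain ⟨l, rfl⟩ : ∃ l, m = l + 2 := ⟨m - 2, by omega⟩
  let Sl : Matrix (Fin (l + 2) × Fin n) (Fin l × Fin n) K := Matrix.of fun x y =>
    if (x.1 : ℕ) = y.1 + 1 ∧ x.2 = y.2 then 1 else 0
  let B1 : Matrix (Fin (l + 2) × Fin n) (Fin (l + 2) × Fin n) K :=
    window _ _ (oddBlock a) (k + 1) k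
  let B2 : Matrix (Fin l × Fin n) (Fin (l + 2) × Fin n) K :=
    window _ _ (oddBlock a) (k + 1 + (l + 2 : ℕ)) k
  let A1 : Matrix (Fin (l + 2) × Fin n) (Fin l × Fin n) K :=
    window _ _ (evenBlock a) (k + 1) (k + 1)
  let A2 : Matrix (Fin l × Fin n) (Fin l × Fin n) K :=
    window _ _ (evenBlock a) (k + 1 + (l + 2 : ℕ)) (k + 1)
  refine ⟨(Matrix.fromBlocks B1 A1 B2 A2).det, fun μ X hX => ?_⟩
  let R : ℤ → ℤ → Matrix (Fin n) (Fin n) K := fun t j => evenBlock a t j - μ • oddBlock a t j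
  let R1 : Matrix (Fin (l + 2) × Fin n) (Fin l × Fin n) K :=
    window _ _ R (k + 1) (k + 1)
  let R2 : Matrix (Fin l × Fin n) (Fin l × Fin n) K :=
    window _ _ R (k + 1 + (l + 2 : ℕ)) (k + 1)
  let rest : Matrix (Fin (l + 2) × Fin n) (Fin l × Fin n) K := Matrix.of fun p y =>
    X (k + 1 + (l + 2 : ℕ) + (y.1 : ℕ)) p y.2
  have hSl : ∀ {p : ℕ} (t : ℤ), window p (l + 2) (oddBlock a) t k * Sl =
      window p l (oddBlock a) t (k + 1) := by
    intro p t
    ext x ⟨j, v⟩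
    rw [Matrix.mul_apply, Finset.sum_eq_single ((⟨j + 1, by omega⟩ : Fin (l + 2)), v)]
    · simp [Sl, window, add_assoc, add_comm (1 : ℤ)]
    · rintro ⟨i, u⟩ _ hne
      have : ¬((i : ℕ) = j + 1 ∧ u = v) := by
        rintro ⟨h1, h2⟩
        exact hne (Prod.ext (Fin.ext h1) h2)
      simp [Sl, this]
    · simp
  -- The columns of O subtracted with factor μ in `R` already occur in `B1`, `B2`; `Sl` selects
  -- them. This column operation removes the dependence on μ.
  have h1 : Matrix.fromBlocks B1 R1 B2 R2 =
      Matrix.fromBlocks B1 A1 B2 A2 * Matrix.fromBlocks 1 (-μ • Sl) 0 1 := by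
    rw [Matrix.fromBlocks_multiply]
    simp only [Matrix.mul_one, Matrix.mul_zero, add_zero]
    congr 1
    · rw [Matrix.mul_smul, hSl]
      ext x y
      simp [R1, R, A1, window]
      ring
    · rw [Matrix.mul_smul, hSl]
      ext x y
      simp [R2, R, A2, window]
      ring
  have hR2 : R2.det = 1 := by
    refine det_of_blockUpper R2 (fun p c h => ?_) fun i u v => ?_
    · have := Fin.lt_def.1 h
      simp only [R2, R, window, Matrix.of_apply]
      rw [evenBlock_eq_zero a hm (Or.inl (by push_cast; omega)),
        oddBlock_eq_zero a (Or.inl (by push_cast; omega))]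
      simp
    · simp only [R2, R, window, Matrix.of_apply]
      rw [oddBlock_eq_zero a (Or.inl (by push_cast; omega)),
        add_right_comm (k + 1) ((l + 2 : ℕ) : ℤ), evenBlock_leading]
      simp
  have hwin : ∀ {q : ℕ} (U : ℤ → ℤ → Matrix (Fin n) (Fin n) K) (j : ℤ) (p) (y : Fin q × Fin n),
      (rho X (k + 1) * window (l + 2) q U (k + 1) j +
        rest * window l q U (k + 1 + (l + 2 : ℕ)) j) p y =
        (∑ t ∈ Finset.Ico (k + 1) (k + 1 + (l + 2 + l : ℕ)), X t * U t (j + (y.1 : ℕ))) p y.2 := by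
    intro q U j p y
    rw [← sum_fin_eq_sum_Ico, Fin.sum_univ_add]
    simp [Matrix.add_apply, Matrix.mul_apply, Fintype.sum_prod_type, Matrix.sum_apply, rho, rest,
      window, add_assoc]
  -- Applying X to the columns of O gives the odd sums, and to the relations gives 0; the lower
  -- right block is unipotent.
  have h2 : Matrix.fromBlocks (rho X (k + 1)) rest 0 1 * Matrix.fromBlocks B1 R1 B2 R2 =
      Matrix.fromBlocks (rho (oddSum X a) k) 0 B2 R2 := by
    rw [Matrix.fromBlocks_multiply]
    simp only [Matrix.one_mul, Matrix.zero_mul, zero_add]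
    congr 1
    · ext p ⟨j, v⟩
      rw [hwin, sum_mul_oddBlock, rho_apply]
      intro t
      simp only [Finset.mem_Ioo, Finset.mem_Ico]
      push_cast
      omega
    · ext p ⟨j, v⟩
      have hsub : Finset.Icc (k + 1 + (j : ℕ)) (k + 1 + (j : ℕ) + (l + 2 : ℕ)) ⊆
          Finset.Ico (k + 1) (k + 1 + (l + 2 + l : ℕ)) := by
        intro t
        simp only [Finset.mem_Icc, Finset.mem_Ico]
        push_cast
        omega
      rw [hwin]
      simp only [R, Matrix.mul_sub, Matrix.mul_smul, Finset.sum_sub_distrib, ← Finset.smul_sum]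
      rw [sum_mul_evenBlock hX _ _ hsub,
        sum_mul_oddBlock X a _ _ (Finset.Ioo_subset_Icc_self.trans hsub), sub_self]
      rfl
  have h3 := congrArg Matrix.det h2
  rw [h1, Matrix.det_mul, Matrix.det_mul, Matrix.det_fromBlocks_zero₂₁,
    Matrix.det_fromBlocks_zero₂₁, Matrix.det_fromBlocks_zero₁₂, hR2] at h3
  simpa using h3.symm

/-! ### The scaling and lifts -/

theorem Nondegenerate.colSpan_eq (hm : 0 < m) {X Y : MatrixSeq K m n} (hY : Nondegenerate Y)
    (h : ∀ k, colSpan Y k ≤ colSpan X k) : colSpan Y = colSpan X := by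
  have hX := hY.of_colSpan_le h
  funext k
  refine Submodule.eq_of_le_of_finrank_eq (h k) ?_
  rw [colSpan, colSpan, finrank_span_eq_card (hX.linearIndependent hm k),
    finrank_span_eq_card (hY.linearIndependent hm k)]

theorem oddSum_scale (X : MatrixSeq K m n) (a : Coords K m n) (μ : K) (k : ℤ) :
    oddSum X (scale μ a) k = μ • oddSum X a k := by
  rw [oddSum, oddSum, Finset.smul_sum]
  refine Finset.sum_congr rfl fun i _ => ?_
  by_cases hi : Odd (i : ℕ) <;> simp [hi, scale]

theorem HasInvariants.exists_scaled (hm : 0 < m) {X : MatrixSeq K m n} {a : Coords K m n}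
    (hX : Nondegenerate X) (ha : HasInvariants X a) (μ : K) :
    ∃ X' : MatrixSeq K m n, Nondegenerate X' ∧ HasInvariants X' (scale μ a) ∧
      ∀ k, (rho X' k).det * (rho X 0).det = (rho X k).det := by
  obtain ⟨X', ha', h0, hX'⟩ := exists_hasInvariants hm (scale μ a) fun k => by
    rw [det_Q_scale]
    exact ha.det_Q_ne_zero hm hX k
  refine ⟨X', hX', ha', fun k => ?_⟩
  rw [det_proportional hm ha ha' hX (fun k => (det_Q_scale μ a k).symm), h0, Matrix.det_one,
    mul_one]

theorem HasInvariants.twisted_of_scaled (hm : 0 < m) {X Y : MatrixSeq K m n} {a : Coords K m n}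
    {μ : K} {N : ℤ} (hX : Nondegenerate X) (ha : HasInvariants X a)
    (hM : ∃ M : Matrix.SpecialLinearGroup (Fin m × Fin n) K, ∀ k, X (k + N) = M.1 * X k)
    (hY : Nondegenerate Y) (hYa : HasInvariants Y (scale μ a)) :
    ∃ M : Matrix.SpecialLinearGroup (Fin m × Fin n) K, ∀ k, Y (k + N) = M.1 * Y k := by
  obtain ⟨M, hM⟩ := hM
  have hper := ha.periodic hm hX hM
  refine hYa.twisted hm hY (fun k => ?_) ?_
  · funext i
    simp only [scale, hper]
  · have h1 := det_proportional hm ha hYa hX (fun k => (det_Q_scale μ a k).symm) N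
    have h2 : (rho X N).det = (rho X 0).det := by
      rw [← rho_det_SL_mul M X 0, ← zero_add N, ← rho_shift]
      simp only [hM]
    rw [h2, mul_comm] at h1
    exact mul_left_cancel₀ (hX 0) h1

theorem det_oddSum_scaled (hm : Even m) (hm2 : 2 ≤ m) {X X' : MatrixSeq K m n}
    {a : Coords K m n} {μ : K} (ha : HasInvariants X a) (ha' : HasInvariants X' (scale μ a))
    (k : ℤ) : (rho (oddSum X' a) k).det * (rho X (k + 1)).det =
      (rho (oddSum X a) k).det * (rho X' (k + 1)).det := by
  obtain ⟨r, hr⟩ := exists_sylvester_det hm hm2 a k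
  rw [hr μ X' ha', hr 1 X (by rwa [scale_one])]
  ring

theorem nondegenerate_oddSum_scaled_iff (hm : Even m) (hm2 : 2 ≤ m) {X X' : MatrixSeq K m n}
    {a : Coords K m n} {μ : K} (hμ : μ ≠ 0) (hX : Nondegenerate X) (hX' : Nondegenerate X')
    (ha : HasInvariants X a) (ha' : HasInvariants X' (scale μ a)) :
    Nondegenerate (oddSum X' (scale μ a)) ↔ Nondegenerate (oddSum X a) := by
  have h1 : ∀ k, (rho (oddSum X' (scale μ a)) k).det ≠ 0 ↔ (rho (oddSum X' a) k).det ≠ 0 := by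
    intro k
    have : rho (oddSum X' (scale μ a)) k = μ • rho (oddSum X' a) k := by
      ext p c
      simp [rho, oddSum_scale]
    rw [this, Matrix.det_smul]
    simp [hμ]
  refine forall_congr' fun k => (h1 k).trans ?_
  have h2 := det_oddSum_scaled hm hm2 ha ha' k
  have h3 := hX (k + 1)
  have h4 := hX' (k + 1)
  constructor
  · intro h h0
    rw [h0, zero_mul] at h2
    exact mul_ne_zero h h3 h2
  · intro h h0
    rw [h0, zero_mul] at h2
    exact mul_ne_zero h h4 h2.symm

/-- The matrices `lam` relating `W` to the odd sums of `X` are reused for `X'`; the determinant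
identity then follows from the one for the odd sums. -/
theorem exists_scaled_pentagram_lift {s : ℕ} (hs : 0 < s) {X X' W : MatrixSeq K (2 * s) n}
    {a b : Coords K (2 * s) n} {μ : K} (hμ : μ ≠ 0) (hX : Nondegenerate X)
    (hX' : Nondegenerate X') (ha : HasInvariants X a) (ha' : HasInvariants X' (scale μ a))
    (hW : Nondegenerate W) (hb : HasInvariants W b)
    (hWX : pentagramSeq (colSpan X) = colSpan W) :
    ∃ W' : MatrixSeq K (2 * s) n, Nondegenerate W' ∧ HasInvariants W' (scale μ b) ∧
      pentagramSeq (colSpan X') = colSpan W' ∧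
      ∀ k, (rho W' k).det * (rho X (k + 1)).det = (rho W k).det * (rho X' (k + 1)).det := by
  have hm : Even (2 * s) := even_two_mul s
  rw [pentagramSeq_colSpan hX ha] at hWX
  have hle : ∀ k, colSpan W k ≤ colSpan (oddSum X a) k := fun k => by rw [hWX]
  have hF := hW.of_colSpan_le hle
  obtain ⟨lam, hl⟩ := exists_mul_of_colSpan_le hle
  obtain rfl : W = fun k => oddSum X a k * lam k := funext hl
  have hdet : ∀ k, (rho (fun k => oddSum X' a k * lam k) k).det * (rho X (k + 1)).det =
      (rho (fun k => oddSum X a k * lam k) k).det * (rho X' (k + 1)).det := by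
    intro k
    rw [rho_mul_right, rho_mul_right, Matrix.det_mul, Matrix.det_mul]
    linear_combination (Lam lam k).det * det_oddSum_scaled hm (by omega) ha ha' k
  have hW' : Nondegenerate fun k => oddSum X' a k * lam k := by
    intro k h0
    have := hdet k
    rw [h0, zero_mul] at this
    exact mul_ne_zero (hW k) (hX' (k + 1)) this.symm
  refine ⟨_, hW', ha.oddSum_scaled hm (by omega) hX hF ha' hb, ?_, hdet⟩
  rw [pentagramSeq_colSpan hX' ha']
  refine (hW'.colSpan_eq (by omega) fun k => ?_).symm
  refine (colSpan_mul_right_le _ _ _).trans ((colSpan_le_iff _ _ _).2 fun v => ?_)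
  -- The odd sums formed with `scale μ a` and with `a` differ by the factor μ, so they have the same
  -- column spaces.
  have h1 := mulVec_mem_colSpan (oddSum X' (scale μ a)) k (μ⁻¹ • v)
  rwa [oddSum_scale, Matrix.smul_mulVec, Matrix.mulVec_smul, smul_inv_smul₀ hμ] at h1

/-! ### The normal form under the scaling -/

theorem coeff_scale (μ : K) (a : Coords K m n) (k : ℤ) (i : ℕ) :
    coeff (scale μ a) k i = if Odd i then μ • coeff a k i else coeff a k i := by
  unfold coeff scale
  split_ifs <;> simp

theorem prod_ofFn_smul (μ : K) {N : ℕ} (f : Fin N → Matrix (Fin n) (Fin n) K) :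
    (List.ofFn fun j => μ • f j).prod = μ ^ N • (List.ofFn f).prod := by
  induction N with
  | zero => simp
  | succ N ih => rw [List.ofFn_succ, List.ofFn_succ, List.prod_cons, List.prod_cons,
      ih fun j => f j.succ, smul_mul_smul_comm, pow_succ']

/-- The blocks with index 0 are untouched. Since 2s - 1 is odd, each `lastProd` is multiplied by `μ
^ N`, which preserves equalities between its entries. -/
theorem IsNormalForm.scale {ord : LinearOrder K} {N s : ℕ} (hs : 0 < s) {a : Coords K (2 * s) n}
    (h : IsNormalForm ord N a) (μ : K) : IsNormalForm ord N (scale μ a) := by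
  obtain ⟨J, hJ, hord, hprod, hblk, hgen⟩ := h
  have h0 : ∀ k, coeff (GrassmannPentagram.scale μ a) k 0 = coeff a k 0 := fun k => by
    simp [coeff_scale]
  have hodd : Odd (2 * s - 1) := ⟨s - 1, by omega⟩
  have hlast : ∀ k, lastProd N (GrassmannPentagram.scale μ a) k = μ ^ N • lastProd N a k := by
    intro k
    simp only [lastProd, coeff_scale, hodd, if_true]
    exact prod_ofFn_smul μ _
  refine ⟨J, hJ, hord, fun r => ?_, fun k => ?_, fun hd k i j p q hj hp hq => ?_⟩
  · rw [← hprod r]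
    simp only [jordanProd, h0]
  · rw [h0]
    exact hblk k
  · rw [hlast, Matrix.smul_apply, Matrix.smul_apply, hgen hd k i j p q hj hp hq]

/-! ### The pentagram map in coordinates -/

/-- Both lifts have windows of determinant 1, so the matrix carrying one lift to the other lies in
SL. -/
theorem IsCoords.unique {ord : LinearOrder K} {N : ℕ} (hm : 0 < m) {x y : Moduli K m n N}
    {a : Coords K m n} (hx : IsCoords ord x a) (hy : IsCoords ord y a) : x = y := by
  obtain ⟨l, h, X, rfl, hX, hdX, ha, -⟩ := hx
  obtain ⟨l', h', Y, rfl, hY, hdY, ha', -⟩ := hy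
  have hXn : Nondegenerate X := fun k => by simp [hdX]
  obtain ⟨g, hg⟩ : ∃ g : Matrix.SpecialLinearGroup (Fin m × Fin n) K,
      g.1 = rho Y 0 * (rho X 0)⁻¹ :=
    ⟨⟨_, by simp [Matrix.det_mul, Matrix.det_nonsing_inv, hdX, hdY]⟩, rfl⟩
  refine Moduli.mk_eq_iff.2 ⟨g, ?_⟩
  rw [hX.1.eq_colSpan, hY.1.eq_colSpan, ← colSpan_mul_left]
  refine congrArg colSpan (funext fun k => ?_)
  refine ha.eq_mul hm ha' (ha.det_Q_ne_zero hm hXn) _ ?_ k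
  rw [hg, Matrix.mul_assoc, Matrix.nonsing_inv_mul _ (hXn 0).isUnit, Matrix.mul_one]

theorem IsTwistedLift.of_colSpan (hm : 0 < m) {N : ℕ} {l : SubspaceSeq K m n}
    {X : MatrixSeq K m n} (hX : Nondegenerate X) (hl : l = colSpan X)
    (hM : ∃ M : Matrix.SpecialLinearGroup (Fin m × Fin n) K, ∀ k, X (k + N) = M.1 * X k) :
    IsTwistedLift N l X := by
  rw [hl]
  exact ⟨hX.isLift hm, hM⟩

theorem IsCoords.exists_scaled {ord : LinearOrder K} {N s : ℕ} (hs : 0 < s)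
    {x : Moduli K (2 * s) n N} {a : Coords K (2 * s) n} (hx : IsCoords ord x a) (μ : K) :
    ∃ x' : Moduli K (2 * s) n N, IsCoords ord x' (scale μ a) := by
  obtain ⟨l, h, X, rfl, hX, hdX, ha, hn⟩ := hx
  have hm : 0 < 2 * s := by omega
  have hXn : Nondegenerate X := fun k => by simp [hdX]
  obtain ⟨X', hX', ha', hd⟩ := ha.exists_scaled hm hXn μ
  have ht := IsTwistedLift.of_colSpan hm hX' rfl (ha.twisted_of_scaled hm hXn hX.2 hX' ha')
  exact ⟨_, _, ht.isRegularPolygon hm hX', X', rfl, ht, fun k => by simpa [hdX] using hd k, ha',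
    hn.scale hs μ⟩

theorem scale_mem_coordPentagram {ord : LinearOrder K} {N s : ℕ} (hs : 0 < s) {μ : K}
    (hμ : μ ≠ 0) {a b : Coords K (2 * s) n} (h : b ∈ coordPentagram ord s n N a) :
    scale μ b ∈ coordPentagram ord s n N (scale μ a) := by
  obtain ⟨x, y, hx, hy, hyb⟩ := h
  have hm : 0 < 2 * s := by omega
  obtain ⟨x', hx'⟩ := hx.exists_scaled hs μ
  obtain ⟨l, h, X, rfl, hX, hdX, ha, -⟩ := hx
  obtain ⟨l', h', X', rfl, hX', hdX', ha', hn'⟩ := id hx'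
  obtain rfl := hX.1.eq_colSpan
  obtain rfl := hX'.1.eq_colSpan
  obtain ⟨hp, rfl⟩ := mem_pentagram_mk_iff.1 hy
  obtain ⟨W, hW, hdW, hb, hnb⟩ := (isCoords_mk_iff ord).1 hyb
  have hWn : Nondegenerate W := fun k => by simp [hdW]
  obtain ⟨W', hW', hb', hWX', hd⟩ := exists_scaled_pentagram_lift hs hμ (fun k => by simp [hdX])
    (fun k => by simp [hdX']) ha ha' hWn hb hW.1.eq_colSpan
  have ht := IsTwistedLift.of_colSpan hm hW' hWX' (hb.twisted_of_scaled hm hWn hW.2 hW' hb')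
  exact ⟨_, _, hx', mem_pentagram_mk_iff.2 ⟨ht.isRegularPolygon hm hW', rfl⟩,
    (isCoords_mk_iff ord).2 ⟨W', ht, fun k => by simpa [hdX, hdX', hdW] using hd k, hb',
      hnb.scale hs μ⟩⟩

theorem coordPentagram_scale {ord : LinearOrder K} {N s : ℕ} (hs : 0 < s) {μ : K}
    (hμ : μ ≠ 0) (a : Coords K (2 * s) n) :
    coordPentagram ord s n N (scale μ a) = scale μ '' coordPentagram ord s n N a := by
  refine Set.Subset.antisymm (fun b hb => ?_) ?_
  -- The reverse inclusion is the forward one for μ⁻¹.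
  · have h := scale_mem_coordPentagram hs (inv_ne_zero hμ) hb
    rw [scale_scale, inv_mul_cancel₀ hμ, scale_one] at h
    exact ⟨_, h, by rw [scale_scale, mul_inv_cancel₀ hμ, scale_one]⟩
  · rintro _ ⟨b, hb, rfl⟩
    exact scale_mem_coordPentagram hs hμ hb

theorem mem_coordPentagram_iff {ord : LinearOrder K} {N s : ℕ} (hs : 0 < s)
    {x : Moduli K (2 * s) n N} {a : Coords K (2 * s) n} (hx : IsCoords ord x a)
    (b : Coords K (2 * s) n) :
    b ∈ coordPentagram ord s n N a ↔ IsCompatible ord N a b := by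
  have hm : 0 < 2 * s := by omega
  have hrho : ∀ {X : MatrixSeq K (2 * s) n}, HasInvariants X a → ∀ lam k,
      rho (fun k => oddSum X a k * lam k) k = rho X k * (Nmat a k * Lam lam k) := by
    intro X ha lam k
    rw [rho_mul_right, ha.rho_oddSum hm, Matrix.mul_assoc]
  constructor
  · rintro ⟨x', y, hx', hy, hyb⟩
    obtain ⟨l, h, X, rfl, hX, hdX, ha, -⟩ := hx'
    obtain rfl := hX.1.eq_colSpan
    have hXn : Nondegenerate X := fun k => by simp [hdX]
    obtain ⟨hp, rfl⟩ := mem_pentagram_mk_iff.1 hy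
    obtain ⟨W, hW, hdW, hb, hnb⟩ := (isCoords_mk_iff ord).1 hyb
    have hWX := hW.1.eq_colSpan
    rw [pentagramSeq_colSpan hXn ha] at hWX
    obtain ⟨lam, hl⟩ := exists_mul_of_colSpan_le (X := oddSum X a) (Y := W) fun k => by rw [hWX]
    obtain rfl : W = fun k => oddSum X a k * lam k := funext hl
    have hdet : ∀ k, (Nmat a k * Lam lam k).det = 1 := fun k => by
      have := hdW k
      rwa [hrho ha, Matrix.det_mul, hdX, one_mul] at this
    obtain ⟨M, hM⟩ := hW.2
    refine ⟨lam, hdet, fun k => ?_, hb.periodic hm (fun k => by simp [hdW]) hM, hnb⟩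
    have h1 := hb.rho_succ hm k
    rw [hrho ha, hrho ha, ha.rho_succ hm, Matrix.mul_assoc, Matrix.mul_assoc] at h1
    have h2 := ((Matrix.isUnit_iff_isUnit_det _).2 (hXn k).isUnit).mul_left_cancel h1
    rw [← Matrix.mul_inv_rev, Matrix.mul_assoc, Matrix.mul_assoc, h2, ← Matrix.mul_assoc,
      Matrix.nonsing_inv_mul _ (by rw [hdet]; exact isUnit_one), Matrix.one_mul]
  · rintro ⟨lam, hdet, hQ, hper, hnb⟩
    have hx' := hx
    obtain ⟨l, h, X, rfl, hX, hdX, ha, -⟩ := hx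
    obtain rfl := hX.1.eq_colSpan
    have hXn : Nondegenerate X := fun k => by simp [hdX]
    have hdW : ∀ k, (rho (fun k => oddSum X a k * lam k) k).det = 1 := fun k => by
      rw [hrho ha, Matrix.det_mul, hdX, hdet, one_mul]
    have hWn : Nondegenerate fun k => oddSum X a k * lam k := fun k => by simp [hdW]
    have hb : HasInvariants (fun k => oddSum X a k * lam k) b := by
      intro k
      refine (rho_succ_iff hm (fun k => oddSum X a k * lam k) b k).1 ?_
      rw [hrho ha, hrho ha, ha.rho_succ hm, Matrix.mul_assoc, Matrix.mul_assoc, hQ,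
        ← Matrix.mul_inv_rev, Matrix.mul_assoc _ (Q a k), Matrix.mul_assoc _ (Q a k * _),
        ← Matrix.mul_assoc (Nmat a k * Lam lam k),
        Matrix.mul_nonsing_inv _ (by rw [hdet]; exact isUnit_one), Matrix.one_mul,
        Matrix.mul_assoc]
    have hWX : pentagramSeq (colSpan X) = colSpan fun k => oddSum X a k * lam k := by
      rw [pentagramSeq_colSpan hXn ha]
      exact (hWn.colSpan_eq hm fun k => colSpan_mul_right_le _ _ _).symm
    have ht := IsTwistedLift.of_colSpan (N := N) hm hWn hWX
      -- Periodicity of `b` produces a monodromy, and the windows of determinant 1 put it in SL.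
      (hb.twisted hm hWn hper (by rw [hdW, hdW]))
    exact ⟨_, _, hx', mem_pentagram_mk_iff.2 ⟨ht.isRegularPolygon hm hWn, rfl⟩,
      (isCoords_mk_iff ord).2 ⟨_, ht, hdW, hb, hnb⟩⟩

/-! ### Invariants of arbitrary twisted lifts -/

theorem IsInvariants.exists_scaled {N : ℕ} (hm : 0 < m) {x : Moduli K m n N} {a : Coords K m n}
    (hx : IsInvariants x a) (μ : K) : ∃ x' : Moduli K m n N, IsInvariants x' (scale μ a) := by
  obtain ⟨l, h, X, rfl, hX, ha⟩ := hx
  have hXn := h.2.nondegenerate hX.1.eq_colSpan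
  obtain ⟨X', hX', ha', -⟩ := ha.exists_scaled hm hXn μ
  have ht := IsTwistedLift.of_colSpan hm hX' rfl (ha.twisted_of_scaled hm hXn hX.2 hX' ha')
  exact ⟨_, _, ht.isRegularPolygon hm hX', X', rfl, ht, ha'⟩

/-- The transfer of lifts works for every nondegenerate `X'` with the scaled invariants, hence for
every choice of `x'`, with no determinant normalization. -/
theorem IsInvariants.pentagram_scaled {N s : ℕ} (hs : 0 < s) {μ : K} (hμ : μ ≠ 0)
    {x x' : Moduli K (2 * s) n N} {a : Coords K (2 * s) n} (hx : IsInvariants x a)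
    (hx' : IsInvariants x' (scale μ a)) :
    ((pentagram K s n N x).Dom ↔ (pentagram K s n N x').Dom) ∧
      ∀ y ∈ pentagram K s n N x, ∀ y' ∈ pentagram K s n N x', ∀ b,
        IsInvariants y b → IsInvariants y' (scale μ b) := by
  have hm : 0 < 2 * s := by omega
  obtain ⟨l, h, X, rfl, hX, ha⟩ := hx
  obtain ⟨l', h', X', rfl, hX', ha'⟩ := hx'
  obtain rfl := hX.1.eq_colSpan
  obtain rfl := hX'.1.eq_colSpan
  have hXn := h.2.nondegenerate rfl
  have hXn' := h'.2.nondegenerate rfl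
  refine ⟨?_, fun y hy y' hy' b hyb => ?_⟩
  · rw [pentagram_dom_mk_iff, pentagram_dom_mk_iff,
      isRegularPolygon_pentagramSeq_iff hs hXn ha h,
      isRegularPolygon_pentagramSeq_iff hs hXn' ha' h',
      nondegenerate_oddSum_scaled_iff (even_two_mul s) (by omega) hμ hXn hXn' ha ha']
  · obtain ⟨hp, rfl⟩ := mem_pentagram_mk_iff.1 hy
    obtain ⟨hp', rfl⟩ := mem_pentagram_mk_iff.1 hy'
    obtain ⟨W, hW, hb⟩ := isInvariants_mk_iff.1 hyb
    have hWn := hp.2.nondegenerate hW.1.eq_colSpan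
    obtain ⟨W', hW', hb', hWX', -⟩ := exists_scaled_pentagram_lift hs hμ hXn hXn' ha ha' hWn hb
      hW.1.eq_colSpan
    exact isInvariants_mk_iff.2 ⟨W', IsTwistedLift.of_colSpan hm hW' hWX'
      (hb.twisted_of_scaled hm hWn hW.2 hW' hb'), hb'⟩

end GrassmannPentagram

end

theorem mainTheorem2 {K : Type*} [RCLike K] (ord : LinearOrder K) (s n N : ℕ)
    (hs : 2 ≤ s) (hn : 1 ≤ n) (hN : 1 ≤ N) (μ : K) (hμ : μ ≠ 0) :
    -- moduli coordinates determine the point of the moduli space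
    (∀ (x y : Moduli K (2 * s) n N) (a : Coords K (2 * s) n),
      IsCoords ord x a → IsCoords ord y a → x = y) ∧
    -- the scaling maps moduli coordinates to moduli coordinates
    (∀ (x : Moduli K (2 * s) n N) (a : Coords K (2 * s) n), IsCoords ord x a →
      ∃ x' : Moduli K (2 * s) n N, IsCoords ord x' (scale μ a)) ∧
    -- in coordinates the pentagram map is given by the compatibility formula
    (∀ (x : Moduli K (2 * s) n N) (a : Coords K (2 * s) n), IsCoords ord x a →
      ∀ b, b ∈ coordPentagram ord s n N a ↔ IsCompatible ord N a b) ∧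
    -- the pentagram map in coordinates commutes with the scaling
    (∀ a : Coords K (2 * s) n,
      coordPentagram ord s n N (scale μ a) = scale μ '' coordPentagram ord s n N a) ∧
    -- the same for the invariants of arbitrary twisted lifts
    (∀ (x : Moduli K (2 * s) n N) (a : Coords K (2 * s) n), IsInvariants x a →
      (∃ x' : Moduli K (2 * s) n N, IsInvariants x' (scale μ a)) ∧
      ∀ x' : Moduli K (2 * s) n N, IsInvariants x' (scale μ a) →
        ((pentagram K s n N x).Dom ↔ (pentagram K s n N x').Dom) ∧
        ∀ y ∈ pentagram K s n N x, ∀ y' ∈ pentagram K s n N x', ∀ b,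
          IsInvariants y b → IsInvariants y' (scale μ b)) := by
  have hs0 : 0 < s := by omega
  exact ⟨fun _ _ _ hx hy => hx.unique (by omega) hy,
    fun _ _ hx => hx.exists_scaled hs0 μ,
    fun _ _ hx b => mem_coordPentagram_iff hs0 hx b,
    fun a => coordPentagram_scale hs0 hμ a,
    fun _ _ hx => ⟨hx.exists_scaled (by omega) μ,
      fun _ hx' => hx.pentagram_scaled hs0 hμ hx'⟩⟩
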